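/- Call $\rho:\mathbb R\to\mathbb R$ admissible if $\rho>0$ and $\rho-1$ is in the Schwartz class. For such $\rho$ let $$S(x)=x+\int_{-\infty}^x(\rho(y)-1)\,dy,\qquad \rho_s(\xi)=\rho(x)\ \text{ at }\ \xi=S(x),\qquad (U_\rho f)(\xi)=\sqrt{\rho_s(\xi)}\,f(S^{-1}(\xi)).$$ For $q:\mathbb R\to\mathbb R$, the Schrödinger operator $D_\xi^2-q$ is called the Liouville transform of the acoustic operator $\rho^{-2}D_x^2$ if $U_\rho(\rho^{-2}f'')=(D_\xi^2-q)\,U_\rho f$ for all $f\in C^2(\mathbb R,\mathbb C)$. For real $k$ let $\psi_{s,\pm}(\xi,k)$ and $\varphi_{s,+}(\xi,k)$ denote the solutions of $\psi''-q\psi=-k^2\psi$ with $e^{\mp ik\xi}\psi_{s,\pm}\to1$ as $\xi\to+\infty$ and $e^{ik\xi}\varphi_{s,+}\to1$ as $\xi\to-\infty$; write $\psi_s(\xi,0)=\psi_{s,\pm}(\xi,0)$. For $k\neq0$ let $a(k),b(k)$ be defined by $\varphi_{s,+}=a\,\psi_{s,-}+b\,\psi_{s,+}$; the condition $a(0)=1$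 means that $a(k)\to1$ as $k\to0$, $k\in\mathbb R\setminus\{0\}$. A bound state is a nonzero $\psi\in L^2(\mathbb R)$ with $\psi''-q\psi=\omega^2\psi$ for some $\omega>0$. **Theorem.** For every admissible $\rho$ the map $S:\mathbb R\to\mathbb R$ is a bijection, and there is exactly one $q:\mathbb R\to\mathbb R$ such that $D_\xi^2-q$ is the Liouville transform of $\rho^{-2}D_x^2$. A Schrödinger operator $D_\xi^2-q$ with $q:\mathbb R\to\mathbb R$ is the Liouville transform of the acoustic operator of some admissible $\rho$ if and only if $q$ is in the Schwartz class, $D_\xi^2-q$ has no bound states, and $a(0)=1$. The inversion of the Liouville transformation is explicit: if $D_\xi^2-q$ is the Liouville transform of $\rho^{-2}D_x^2$ with $\rho$ admissible, then $\psi_s(\cdot,0)$ exists and is unique, $1/\rho_s-1$ is integrable, and $$\rho_s(\xi)=\psi_s(\xi,0)^2,\qquad x=S^{-1}(\xi)=\xi+\int_{-\infty}^{\xi}\Big(\frac1{\rho_s(\xi')}-1\Big)\,d\xi'\qquad(\xi\in\mathbb R).$$ -/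

import Mathlib

open Filter Topology MeasureTheory

noncomputable section

/-- A real function on the line belongs to the Schwartz class. -/
def IsSchwartz (f : ℝ → ℝ) : Prop :=
  ∃ g : SchwartzMap ℝ ℝ, ∀ x, g x = f x

/-- Admissible acoustic coefficients: `ρ` is real and positive, and `ρ - 1` is in the Schwartz
class. -/
def IsAcoustic (ρ : ℝ → ℝ) : Prop :=
  (∀ x, 0 < ρ x) ∧ IsSchwartz (fun x => ρ x - 1)

/-- The acoustic operator `ρ⁻² D²`. -/
def acousticOp (ρ : ℝ → ℝ) (f : ℝ → ℂ) : ℝ → ℂ :=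
  fun x => ((ρ x : ℂ) ^ 2)⁻¹ * deriv (deriv f) x

/-- The Schrödinger operator `D² - q`. -/
def schrodingerOp (q : ℝ → ℝ) (g : ℝ → ℂ) : ℝ → ℂ :=
  fun ξ => deriv (deriv g) ξ - (q ξ : ℂ) * g ξ

/-- The travel time `S(x) = x + ∫_{-∞}^x (ρ(y) - 1) dy`. -/
def travelTime (ρ : ℝ → ℝ) (x : ℝ) : ℝ :=
  x + ∫ y in Set.Iic x, (ρ y - 1)

/-- The inverse `ξ ↦ x` of the change of variables `ξ = S(x)`. -/
def travelTimeInv (ρ : ℝ → ℝ) : ℝ → ℝ :=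
  Function.invFun (travelTime ρ)

/-- The acoustic coefficient in the travel time variable: `ρ_s(ξ) = ρ(x)` at `ξ = S(x)`. -/
def rhoS (ρ : ℝ → ℝ) (ξ : ℝ) : ℝ :=
  ρ (travelTimeInv ρ ξ)

/-- The Liouville map on functions: the change of variables `f ↦ f ∘ S⁻¹`, followed by
multiplication by `√ρ_s`. -/
def liouvilleMap (ρ : ℝ → ℝ) (f : ℝ → ℂ) : ℝ → ℂ :=
  fun ξ => (Real.sqrt (rhoS ρ ξ) : ℂ) * f (travelTimeInv ρ ξ)

/-- `D² - q` is the Liouville transform of the acoustic operator `ρ⁻² D²`: the Liouville map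
carries the second operator to the first one. -/
def IsLiouvilleTransform (ρ q : ℝ → ℝ) : Prop :=
  ∀ f : ℝ → ℂ, ContDiff ℝ 2 f →
    liouvilleMap ρ (acousticOp ρ f) = schrodingerOp q (liouvilleMap ρ f)

/-- Classical solutions of the Schrödinger equation `(D² - q) ψ = -k² ψ`. -/
def IsWave (q : ℝ → ℝ) (k : ℂ) (ψ : ℝ → ℂ) : Prop :=
  ContDiff ℝ 2 ψ ∧ ∀ ξ, schrodingerOp q ψ ξ = -k ^ 2 * ψ ξ

/-- `ψ = ψ_{s,+}(·, k)`: the wave function with `e^{-ikξ} ψ → 1` as `ξ → +∞`. For real `k`,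
`ψ_{s,-}(·, k)` is `ψ_{s,+}(·, -k)`. -/
def IsRightWave (q : ℝ → ℝ) (k : ℝ) (ψ : ℝ → ℂ) : Prop :=
  IsWave q k ψ ∧
    Tendsto (fun ξ : ℝ => Complex.exp (-(Complex.I * k * ξ)) * ψ ξ) atTop (𝓝 1)

/-- `φ = φ_{s,+}(·, k)`: the wave function with `e^{ikξ} φ → 1` as `ξ → -∞`. -/
def IsLeftWave (q : ℝ → ℝ) (k : ℝ) (φ : ℝ → ℂ) : Prop :=
  IsWave q k φ ∧
    Tendsto (fun ξ : ℝ => Complex.exp (Complex.I * k * ξ) * φ ξ) atBot (𝓝 1)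

/-- `(a, b)` is the scattering data of `D² - q`: for real `k ≠ 0`,
`φ_+(ξ, k) = a(k) ψ_-(ξ, k) + b(k) ψ_+(ξ, k)`. Nothing is imposed at `k = 0`. -/
def IsScatteringData (q : ℝ → ℝ) (a b : ℝ → ℂ) : Prop :=
  ∀ k : ℝ, k ≠ 0 → ∃ φ ψp ψm : ℝ → ℂ,
    IsLeftWave q k φ ∧ IsRightWave q k ψp ∧ IsRightWave q (-k) ψm ∧
      ∀ ξ, φ ξ = a k * ψm ξ + b k * ψp ξ

/-- `a(0) = 1`: the coefficient `a(k)`, defined for `k ≠ 0`, extends continuously to `k = 0` with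
the value `1`. (In general `a` has a pole at `0`.) -/
def AZeroEqOne (q : ℝ → ℝ) : Prop :=
  ∃ a b : ℝ → ℂ, IsScatteringData q a b ∧ Tendsto a (𝓝[≠] 0) (𝓝 1)

/-- A bound state: a nonzero `L²` wave function with negative energy `k² = -ω²`, `k = iω`. -/
def HasBoundState (q : ℝ → ℝ) : Prop :=
  ∃ ω : ℝ, 0 < ω ∧ ∃ ψ : ℝ → ℂ,
    ψ ≠ 0 ∧ IsWave q (Complex.I * ω) ψ ∧ MemLp ψ 2 (volume : Measure ℝ)

end

/-! Put `σ = √ρ_s` and `X = S⁻¹`, so that `X' = σ⁻²`. The weight `√ρ_s` is the one for which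
first-order terms cancel: `(σ · f∘X)'' = σ'' · f∘X + U_ρ(ρ⁻² f'')`. Hence `D² - q` is the Liouville
transform exactly when `σ'' = q σ` (`isLiouvilleTransform_iff`). The theorem thus concerns a
positive zero-energy solution tending to 1 at both ends.

Inversion. A second zero-energy solution is `σ X`, which is unbounded, so `σ` is the only solution
tending to 1 at `+∞`. Since `X' - 1 = 1/ρ_s - 1` and `X(ξ) - ξ → 0` at `-∞`, the map `X` is itself
the travel time of `1/ρ_s`. Consequently `ρ ↦ 1/ρ_s` is an involution on admissible coefficients.

Necessity. The positive solution `σ` factorizes the operator and excludes square integrable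
solutions at negative energy (`eq_zero_of_sq_integrable`). If the zero-energy Jost solutions satisfy
`φ₀ = c ψ₀` with `ψ₀(0) ≠ 0`, then `a(k) → (c + c⁻¹)/2` (`tendsto_jostWronskian_div`); here both
equal `σ` and `c = 1`.

Sufficiency. Jost solutions come from a Volterra equation solved uniformly for `Im k ≥ 0`.
Finiteness of `a(0)` makes the Wronskian of `φ₀` and `ψ₀` vanish, so `φ₀ = c ψ₀`, and `c + c⁻¹ = 2`
forces `c = 1`. The solution decaying like `e^{-ωξ}` is positive for large `ω`. Without bound states
it cannot acquire a zero as `ω` decreases (`realWave_pos_of_not_hasBoundState`), so the real part of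
`ψ₀` is positive. That real part is the required `σ`; its equation makes `σ - 1` Schwartz, and the
involution produces `ρ`. -/

/-! ### Schwartz functions of a real variable -/

/-- A real function which, multiplied by any polynomial, stays bounded. -/
def RapidDecay (f : ℝ → ℝ) : Prop :=
  ∀ N : ℕ, ∃ C, ∀ x, |f x| * (1 + x ^ 2) ^ N ≤ C

namespace IsSchwartz

theorem rapidDecay {f : ℝ → ℝ} (hf : IsSchwartz f) : RapidDecay f := by
  obtain ⟨g, hg⟩ := hf
  intro N
  have key := fun x => SchwartzMap.one_add_le_sup_seminorm_apply (𝕜 := ℝ) (m := (2 * N, 0))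
    (k := 2 * N) (n := 0) le_rfl le_rfl g x
  refine ⟨_, fun x => le_trans ?_ (key x)⟩
  rw [norm_iteratedFDeriv_zero, hg, Real.norm_eq_abs, Real.norm_eq_abs, mul_comm, pow_mul]
  gcongr
  nlinarith [abs_nonneg x, sq_abs x]

theorem exists_hasDerivAt {f : ℝ → ℝ} (hf : IsSchwartz f) :
    ∃ f' : ℝ → ℝ, IsSchwartz f' ∧ ∀ x, HasDerivAt f (f' x) x := by
  obtain ⟨g, hg⟩ := hf
  obtain rfl : (g : ℝ → ℝ) = f := funext hg
  refine ⟨SchwartzMap.derivCLM ℝ ℝ g, ⟨_, fun _ => rfl⟩, fun x => ?_⟩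
  rw [SchwartzMap.derivCLM_apply]
  exact (g.differentiable x).hasDerivAt

theorem add {f g : ℝ → ℝ} (hf : IsSchwartz f) (hg : IsSchwartz g) :
    IsSchwartz fun x => f x + g x := by
  obtain ⟨F, hF⟩ := hf
  obtain ⟨G, hG⟩ := hg
  exact ⟨F + G, fun x => by simp [hF, hG]⟩

theorem const_mul {f : ℝ → ℝ} (hf : IsSchwartz f) (c : ℝ) : IsSchwartz fun x => c * f x := by
  obtain ⟨F, hF⟩ := hf
  exact ⟨c • F, fun x => by simp [hF]⟩

theorem mul {f g : ℝ → ℝ} (hf : IsSchwartz f) (hg : IsSchwartz g) :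
    IsSchwartz fun x => f x * g x := by
  obtain ⟨F, hF⟩ := hf
  obtain ⟨G, hG⟩ := hg
  exact ⟨SchwartzMap.pairing (ContinuousLinearMap.mul ℝ ℝ) F G, fun x => by
    simp [SchwartzMap.pairing_apply_apply, hF, hG]⟩

theorem congr {f g : ℝ → ℝ} (hf : IsSchwartz f) (h : ∀ x, g x = f x) : IsSchwartz g := by
  obtain rfl : g = f := funext h
  exact hf

theorem integrable {f : ℝ → ℝ} (hf : IsSchwartz f) : Integrable f := by
  obtain ⟨g, hg⟩ := hf
  obtain rfl : (g : ℝ → ℝ) = f := funext hg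
  exact g.integrable

theorem continuous {f : ℝ → ℝ} (hf : IsSchwartz f) : Continuous f := by
  obtain ⟨g, hg⟩ := hf
  obtain rfl : (g : ℝ → ℝ) = f := funext hg
  exact g.continuous

/-- A family of rapidly decaying functions stable under differentiation consists of Schwartz
functions. -/
theorem of_family (𝒞 : Set (ℝ → ℝ)) (hd : ∀ f ∈ 𝒞, RapidDecay f)
    (h𝒞 : ∀ f ∈ 𝒞, ∃ f' ∈ 𝒞, ∀ x, HasDerivAt f (f' x) x) {f : ℝ → ℝ} (hf : f ∈ 𝒞) :
    IsSchwartz f := by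
  have hi : ∀ n : ℕ, iteratedDeriv n f ∈ 𝒞 := by
    intro n
    induction n with
    | zero => simpa using hf
    | succ n ih =>
      obtain ⟨f', hf', h⟩ := h𝒞 _ ih
      rw [iteratedDeriv_succ, funext fun x => (h x).deriv]
      exact hf'
  have hsm : ContDiff ℝ (⊤ : ℕ∞) f := by
    refine contDiff_of_differentiable_iteratedDeriv fun m _ x => ?_
    obtain ⟨f', hf', h⟩ := h𝒞 _ (hi m)
    exact (h x).differentiableAt
  refine ⟨⟨f, hsm, fun k n => ?_⟩, fun _ => rfl⟩
  obtain ⟨C, hC⟩ := hd _ (hi n) k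
  refine ⟨C, fun x => le_trans ?_ (hC x)⟩
  rw [norm_iteratedFDeriv_eq_norm_iteratedDeriv, mul_comm, Real.norm_eq_abs, Real.norm_eq_abs]
  gcongr
  nlinarith [abs_nonneg x, sq_abs x, sq_nonneg (|x| - 1)]

/-- Adjoining `f` to the Schwartz functions gives a family stable under differentiation, so only the
decay of `f` itself is at stake. -/
theorem of_hasDerivAt {f f' : ℝ → ℝ} (hf : RapidDecay f) (h : ∀ x, HasDerivAt f (f' x) x)
    (hf' : IsSchwartz f') : IsSchwartz f := by
  refine of_family (insert f {g | IsSchwartz g}) ?_ ?_ (Set.mem_insert _ _)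
  · rintro g (rfl | hg)
    exacts [hf, hg.rapidDecay]
  · rintro g (rfl | hg)
    · exact ⟨f', Or.inr hf', h⟩
    · obtain ⟨g', hg', h'⟩ := hg.exists_hasDerivAt
      exact ⟨g', Or.inr hg', h'⟩

end IsSchwartz

theorem RapidDecay.of_le_mul {f g : ℝ → ℝ} (hg : RapidDecay g) (K : ℝ)
    (h : ∀ x, |f x| ≤ K * |g x|) : RapidDecay f := by
  intro N
  obtain ⟨C, hC⟩ := hg N
  refine ⟨|K| * C, fun x => ?_⟩
  calc |f x| * (1 + x ^ 2) ^ N ≤ (|K| * |g x|) * (1 + x ^ 2) ^ N := by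
        gcongr
        exact (h x).trans (by gcongr; exact le_abs_self K)
    _ = |K| * (|g x| * (1 + x ^ 2) ^ N) := by ring
    _ ≤ |K| * C := by gcongr; exact hC x

theorem RapidDecay.tendsto_cocompact {f : ℝ → ℝ} (hf : RapidDecay f) :
    Tendsto f (cocompact ℝ) (𝓝 0) := by
  obtain ⟨C, hC⟩ := hf 1
  have h1 : Tendsto (fun x : ℝ => C / (1 + ‖x‖ ^ 2)) (cocompact ℝ) (𝓝 0) := by
    refine Tendsto.div_atTop tendsto_const_nhds ?_
    refine tendsto_atTop_add_const_left _ _ ?_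
    exact (tendsto_pow_atTop two_ne_zero).comp (tendsto_norm_cocompact_atTop (E := ℝ))
  refine squeeze_zero_norm (fun x => ?_) h1
  rw [Real.norm_eq_abs, Real.norm_eq_abs, sq_abs, le_div_iff₀ (by positivity)]
  simpa using hC x

/-- The compositions with `X` form a family stable under differentiation, because `(f ∘ X)' = (f' r)
∘ X` and `f' r = f' (r - 1) + f'`. Bounded displacement makes the weights at `ξ` and at `X ξ`
comparable. The intended `X` is the inverse travel time, with `r = 1/ρ`. -/
theorem IsSchwartz.comp_of_hasDerivAt {f r X : ℝ → ℝ} (hf : IsSchwartz f)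
    (hr : IsSchwartz fun x => r x - 1) (hX : ∀ ξ, HasDerivAt X (r (X ξ)) ξ) {K : ℝ}
    (hK : ∀ ξ, |X ξ - ξ| ≤ K) : IsSchwartz fun ξ => f (X ξ) := by
  refine IsSchwartz.of_family {g | ∃ f, IsSchwartz f ∧ g = fun ξ => f (X ξ)} ?_ ?_ ⟨f, hf, rfl⟩
  · rintro _ ⟨f, hf, rfl⟩ N
    obtain ⟨C, hC⟩ := hf.rapidDecay N
    refine ⟨(2 + 2 * K ^ 2) ^ N * C, fun ξ => ?_⟩
    have h1 : 1 + ξ ^ 2 ≤ (2 + 2 * K ^ 2) * (1 + X ξ ^ 2) := by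
      have h := abs_le.1 (hK ξ)
      have h2 : (X ξ - ξ) ^ 2 ≤ K ^ 2 := sq_le_sq' h.1 h.2
      nlinarith [sq_nonneg (2 * X ξ - ξ), mul_nonneg (sq_nonneg K) (sq_nonneg (X ξ))]
    calc |f (X ξ)| * (1 + ξ ^ 2) ^ N
        ≤ |f (X ξ)| * ((2 + 2 * K ^ 2) * (1 + X ξ ^ 2)) ^ N := by gcongr
      _ = (2 + 2 * K ^ 2) ^ N * (|f (X ξ)| * (1 + X ξ ^ 2) ^ N) := by rw [mul_pow]; ring
      _ ≤ _ := by gcongr; exact hC _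
  · rintro _ ⟨f, hf, rfl⟩
    obtain ⟨f', hf', h⟩ := hf.exists_hasDerivAt
    refine ⟨_, ⟨fun x => f' x * r x, ?_, rfl⟩, fun ξ => (h (X ξ)).comp ξ (hX ξ)⟩
    exact ((hf'.mul hr).add hf').congr fun x => by ring

/-! ### Admissible coefficients: bounds, powers and roots. -/

namespace IsAcoustic

variable {ρ : ℝ → ℝ}

theorem exists_hasDerivAt (hρ : IsAcoustic ρ) :
    ∃ ρ' : ℝ → ℝ, IsSchwartz ρ' ∧ ∀ x, HasDerivAt ρ (ρ' x) x := by
  obtain ⟨ρ', h', h⟩ := hρ.2.exists_hasDerivAt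
  exact ⟨ρ', h', fun x => by simpa using (h x).add_const 1⟩

theorem continuous (hρ : IsAcoustic ρ) : Continuous ρ := by
  simpa using hρ.2.continuous.add_const 1

theorem tendsto_cocompact (hρ : IsAcoustic ρ) : Tendsto ρ (cocompact ℝ) (𝓝 1) := by
  simpa using hρ.2.rapidDecay.tendsto_cocompact.add_const 1

theorem exists_bounds (hρ : IsAcoustic ρ) :
    ∃ δ K, 0 < δ ∧ ∀ x, δ ≤ ρ x ∧ ρ x ≤ K := by
  have h1 : ∀ᶠ x in cocompact ℝ, ρ x ∈ Set.Ioo (1 / 2 : ℝ) 2 :=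
    hρ.tendsto_cocompact (Ioo_mem_nhds (by norm_num) (by norm_num))
  obtain ⟨s, hs, hsub⟩ := mem_cocompact.1 h1
  obtain rfl | hne := s.eq_empty_or_nonempty
  · refine ⟨1 / 2, 2, by norm_num, fun x => ?_⟩
    have : ρ x ∈ Set.Ioo (1 / 2 : ℝ) 2 := hsub (by simp)
    exact ⟨this.1.le, this.2.le⟩
  obtain ⟨a, ha, hmin⟩ := hs.exists_isMinOn hne hρ.continuous.continuousOn
  obtain ⟨b, hb, hmax⟩ := hs.exists_isMaxOn hne hρ.continuous.continuousOn
  refine ⟨min (ρ a) (1 / 2), max (ρ b) 2, lt_min (hρ.1 a) (by norm_num), fun x => ?_⟩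
  by_cases hx : x ∈ s
  · exact ⟨(min_le_left _ _).trans (hmin hx), (hmax hx).trans (le_max_left _ _)⟩
  · have : ρ x ∈ Set.Ioo (1 / 2 : ℝ) 2 := hsub hx
    exact ⟨(min_le_right _ _).trans this.1.le, this.2.le.trans (le_max_right _ _)⟩

/-- Letting the exponent vary closes the family under differentiation: `(g ρ^s)' = (g' ρ + s g ρ')
ρ^(s-1)`. Decay is inherited from `g` since `ρ` lies between positive constants. Division by `ρ` and
by `√ρ` are the cases used. -/
theorem mul_rpow (hρ : IsAcoustic ρ) {g : ℝ → ℝ} (hg : IsSchwartz g) (s : ℝ) :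
    IsSchwartz fun x => g x * ρ x ^ s := by
  obtain ⟨ρ', hρ', hd⟩ := hρ.exists_hasDerivAt
  obtain ⟨δ, K, hδ, hb⟩ := hρ.exists_bounds
  refine IsSchwartz.of_family {f | ∃ g s, IsSchwartz g ∧ f = fun x => g x * ρ x ^ (s : ℝ)} ?_ ?_
    ⟨g, s, hg, rfl⟩
  · rintro _ ⟨g, s, hg, rfl⟩
    refine hg.rapidDecay.of_le_mul (δ ^ s + K ^ s) fun x => ?_
    have hx := hρ.1 x
    have hK : 0 < K := hx.trans_le (hb x).2
    rw [abs_mul, mul_comm, abs_of_pos (Real.rpow_pos_of_pos hx s)]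
    gcongr
    rcases le_total 0 s with h | h
    · exact (Real.rpow_le_rpow hx.le (hb x).2 h).trans
        (le_add_of_nonneg_left (Real.rpow_nonneg hδ.le _))
    · exact (Real.rpow_le_rpow_of_nonpos hδ (hb x).1 h).trans
        (le_add_of_nonneg_right (Real.rpow_nonneg hK.le _))
  · rintro _ ⟨g, s, hg, rfl⟩
    obtain ⟨g', hg', h⟩ := hg.exists_hasDerivAt
    refine ⟨_, ⟨fun x => (g' x + g' x * (ρ x - 1)) + s * (g x * ρ' x), s - 1,
      (hg'.add (hg'.mul hρ.2)).add ((hg.mul hρ').const_mul s), rfl⟩, fun x => ?_⟩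
    have hx := hρ.1 x
    refine ((h x).mul ((hd x).rpow_const (p := s) (Or.inl hx.ne'))).congr_deriv ?_
    have : ρ x ^ s = ρ x ^ (s - 1) * ρ x := by
      rw [← Real.rpow_add_one hx.ne']; simp
    rw [this]; ring

theorem inv (hρ : IsAcoustic ρ) : IsAcoustic fun x => 1 / ρ x := by
  refine ⟨fun x => one_div_pos.2 (hρ.1 x), ?_⟩
  refine ((hρ.mul_rpow hρ.2 (-1)).const_mul (-1)).congr fun x => ?_
  rw [Real.rpow_neg_one]
  field_simp [(hρ.1 x).ne']
  ring

theorem sqrt (hρ : IsAcoustic ρ) : IsAcoustic fun x => √(ρ x) := by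
  refine ⟨fun x => Real.sqrt_pos.2 (hρ.1 x), ?_⟩
  obtain ⟨ρ', hρ', hd⟩ := hρ.exists_hasDerivAt
  -- Decay comes from `|√ρ - 1| ≤ |ρ - 1|`, and the derivative `½ ρ' ρ^(-1/2)` is Schwartz by
  -- `mul_rpow`.
  refine IsSchwartz.of_hasDerivAt (hρ.2.rapidDecay.of_le_mul 1 fun x => ?_)
    (fun x => ((hd x).sqrt (hρ.1 x).ne').sub_const 1)
    (((hρ.mul_rpow hρ' (-(1 / 2))).const_mul (1 / 2)).congr fun x => ?_)
  · have h : ρ x - 1 = (√(ρ x) - 1) * (√(ρ x) + 1) := by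
      nlinarith [Real.sq_sqrt (hρ.1 x).le]
    rw [h, abs_mul, one_mul]
    refine le_mul_of_one_le_right (abs_nonneg _) ?_
    exact (le_add_of_nonneg_left (Real.sqrt_nonneg _)).trans (le_abs_self _)
  · rw [Real.rpow_neg (hρ.1 x).le, ← Real.sqrt_eq_rpow]
    field_simp

theorem sq (hρ : IsAcoustic ρ) : IsAcoustic fun x => ρ x ^ 2 := by
  refine ⟨fun x => pow_pos (hρ.1 x) 2, ?_⟩
  exact ((hρ.2.mul hρ.2).add (hρ.2.const_mul 2)).congr fun x => by ring

/-! ### The travel time -/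

theorem travelTime_sub (hρ : IsAcoustic ρ) (x : ℝ) :
    travelTime ρ x = x + ((∫ y in Set.Iic 0, (ρ y - 1)) + ∫ y in (0 : ℝ)..x, (ρ y - 1)) := by
  have h := intervalIntegral.integral_Iic_sub_Iic (μ := volume) (f := fun y => ρ y - 1)
    (a := 0) (b := x) hρ.2.integrable.integrableOn hρ.2.integrable.integrableOn
  rw [travelTime, ← h]; ring

theorem hasDerivAt_travelTime (hρ : IsAcoustic ρ) (x : ℝ) :
    HasDerivAt (travelTime ρ) (ρ x) x := by
  rw [funext hρ.travelTime_sub]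
  have h := (hρ.2.continuous.integral_hasStrictDerivAt 0 x).hasDerivAt
  exact ((hasDerivAt_id x).add (h.const_add (∫ y in Set.Iic 0, (ρ y - 1)))).congr_deriv (by ring)

theorem abs_travelTime_sub_le (hρ : IsAcoustic ρ) (x : ℝ) :
    |travelTime ρ x - x| ≤ ∫ y, |ρ y - 1| := by
  rw [travelTime, add_sub_cancel_left]
  refine (abs_integral_le_integral_abs).trans ?_
  exact setIntegral_le_integral hρ.2.integrable.abs (Eventually.of_forall fun _ => abs_nonneg _)

theorem tendsto_travelTime_sub_atBot (hρ : IsAcoustic ρ) :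
    Tendsto (fun x => travelTime ρ x - x) atBot (𝓝 0) := by
  have h := intervalIntegral_tendsto_integral_Iic (μ := volume) (f := fun y => ρ y - 1) 0
    hρ.2.integrable.integrableOn tendsto_id
  have h2 := (tendsto_const_nhds (x := ∫ y in Set.Iic 0, (ρ y - 1))).sub h
  rw [sub_self] at h2
  refine h2.congr fun x => ?_
  rw [hρ.travelTime_sub, id, intervalIntegral.integral_symm]
  ring

theorem strictMono_travelTime (hρ : IsAcoustic ρ) : StrictMono (travelTime ρ) :=
  strictMono_of_deriv_pos fun x => by
    rw [(hρ.hasDerivAt_travelTime x).deriv]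
    exact hρ.1 x

theorem bijective_travelTime (hρ : IsAcoustic ρ) : Function.Bijective (travelTime ρ) := by
  refine ⟨hρ.strictMono_travelTime.injective, ?_⟩
  have hb := hρ.abs_travelTime_sub_le
  have hc : Continuous (travelTime ρ) :=
    continuous_iff_continuousAt.2 fun x => (hρ.hasDerivAt_travelTime x).continuousAt
  refine hc.surjective ?_ ?_
  · refine tendsto_atTop_mono (fun x => ?_) (tendsto_atTop_add_const_right _
      (-∫ y, |ρ y - 1|) tendsto_id)
    have := (abs_le.1 (hb x)).1
    simp only [id]; linarith
  · refine tendsto_atBot_mono (fun x => ?_) (tendsto_atBot_add_const_right _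
      (∫ y, |ρ y - 1|) tendsto_id)
    have := (abs_le.1 (hb x)).2
    simp only [id]; linarith

theorem travelTimeInv_travelTime (hρ : IsAcoustic ρ) (x : ℝ) :
    travelTimeInv ρ (travelTime ρ x) = x :=
  Function.leftInverse_invFun hρ.bijective_travelTime.1 x

theorem travelTime_travelTimeInv (hρ : IsAcoustic ρ) (ξ : ℝ) :
    travelTime ρ (travelTimeInv ρ ξ) = ξ :=
  Function.rightInverse_invFun hρ.bijective_travelTime.2 ξ

theorem continuous_travelTimeInv (hρ : IsAcoustic ρ) : Continuous (travelTimeInv ρ) := by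
  let e : ℝ ≃o ℝ := StrictMono.orderIsoOfRightInverse (travelTime ρ) hρ.strictMono_travelTime
    (travelTimeInv ρ) hρ.travelTime_travelTimeInv
  exact e.symm.continuous

theorem hasDerivAt_travelTimeInv (hρ : IsAcoustic ρ) (ξ : ℝ) :
    HasDerivAt (travelTimeInv ρ) (1 / rhoS ρ ξ) ξ := by
  rw [one_div]
  exact HasDerivAt.of_local_left_inverse hρ.continuous_travelTimeInv.continuousAt
    (hρ.hasDerivAt_travelTime _) (hρ.1 _).ne' (Eventually.of_forall hρ.travelTime_travelTimeInv)

theorem abs_travelTimeInv_sub_le (hρ : IsAcoustic ρ) (ξ : ℝ) :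
    |travelTimeInv ρ ξ - ξ| ≤ ∫ y, |ρ y - 1| := by
  have h := hρ.abs_travelTime_sub_le (travelTimeInv ρ ξ)
  rwa [hρ.travelTime_travelTimeInv, abs_sub_comm] at h

theorem rhoS (hρ : IsAcoustic ρ) : IsAcoustic (rhoS ρ) :=
  ⟨fun _ => hρ.1 _, hρ.2.comp_of_hasDerivAt hρ.inv.2 hρ.hasDerivAt_travelTimeInv
    hρ.abs_travelTimeInv_sub_le⟩

theorem tendsto_travelTimeInv_atBot (hρ : IsAcoustic ρ) :
    Tendsto (travelTimeInv ρ) atBot atBot := by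
  refine tendsto_atBot_mono (fun x => ?_) (tendsto_atBot_add_const_right _
      (∫ y, |ρ y - 1|) tendsto_id)
  have := (abs_le.1 (hρ.abs_travelTimeInv_sub_le x)).2
  simp only [id]; linarith

/-- The inverse of the travel time is the travel time of the slowness `1 / ρ_s`. -/
theorem travelTime_inv_rhoS (hρ : IsAcoustic ρ) :
    travelTime (fun ξ => 1 / _root_.rhoS ρ ξ) = travelTimeInv ρ := by
  funext ξ
  -- This limit fixes the constant of integration: `S⁻¹(ξ) - ξ` has derivative `1/ρ_s - 1`, hence is
  -- its integral from `-∞`.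
  have h0 : Tendsto (fun ξ => travelTimeInv ρ ξ - ξ) atBot (𝓝 0) := by
    have h := (hρ.tendsto_travelTime_sub_atBot.comp hρ.tendsto_travelTimeInv_atBot).neg
    rw [neg_zero] at h
    refine h.congr fun ξ => ?_
    simp [hρ.travelTime_travelTimeInv]
  have h := integral_Iic_of_hasDerivAt_of_tendsto' (a := ξ)
    (fun x _ => (hρ.hasDerivAt_travelTimeInv x).sub (hasDerivAt_id x))
    hρ.rhoS.inv.2.integrable.integrableOn h0
  rw [travelTime, h]
  simp

theorem travelTimeInv_inv_rhoS (hρ : IsAcoustic ρ) :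
    travelTimeInv (fun ξ => 1 / _root_.rhoS ρ ξ) = travelTime ρ := by
  funext x
  have h := hρ.rhoS.inv.travelTime_travelTimeInv x
  rw [hρ.travelTime_inv_rhoS] at h
  rw [← h, hρ.travelTime_travelTimeInv, h]

/-- This is the involution `ρ ↦ 1/ρ_s`. It inverts `ρ ↦ ρ_s`: a prescribed admissible `ρ_s` is
reached by applying the statement to its reciprocal. -/
theorem rhoS_inv_rhoS (hρ : IsAcoustic ρ) (x : ℝ) :
    _root_.rhoS (fun ξ => 1 / _root_.rhoS ρ ξ) x = 1 / ρ x := by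
  rw [_root_.rhoS, hρ.travelTimeInv_inv_rhoS, _root_.rhoS, hρ.travelTimeInv_travelTime]

end IsAcoustic

/-! ### Wave functions as solutions of a first order system -/

theorem IsWave.hasDerivAt {q : ℝ → ℝ} {k : ℂ} {ψ : ℝ → ℂ} (h : IsWave q k ψ) :
    (∀ ξ, HasDerivAt ψ (deriv ψ ξ) ξ) ∧
      ∀ ξ, HasDerivAt (deriv ψ) (((q ξ : ℂ) - k ^ 2) * ψ ξ) ξ := by
  have h1 : ContDiff ℝ 1 (deriv ψ) := h.1.deriv' (n := 1)
  refine ⟨fun ξ => (h.1.differentiable two_ne_zero ξ).hasDerivAt, fun ξ => ?_⟩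
  refine (h1.differentiable one_ne_zero ξ).hasDerivAt.congr_deriv ?_
  have h2 := h.2 ξ
  rw [schrodingerOp, sub_eq_iff_eq_add] at h2
  rw [h2]; ring

theorem IsWave.of_hasDerivAt {q : ℝ → ℝ} (hq : Continuous q) {k : ℂ} {ψ ψ' : ℝ → ℂ}
    (h : ∀ ξ, HasDerivAt ψ (ψ' ξ) ξ)
    (h' : ∀ ξ, HasDerivAt ψ' (((q ξ : ℂ) - k ^ 2) * ψ ξ) ξ) : IsWave q k ψ := by
  have e1 : deriv ψ = ψ' := funext fun ξ => (h ξ).deriv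
  have e2 : deriv ψ' = fun ξ => ((q ξ : ℂ) - k ^ 2) * ψ ξ := funext fun ξ => (h' ξ).deriv
  have hc : Continuous ψ := continuous_iff_continuousAt.2 fun ξ => (h ξ).continuousAt
  refine ⟨?_, fun ξ => ?_⟩
  · rw [show (2 : WithTop ℕ∞) = 1 + 1 from (one_add_one_eq_two).symm,
      contDiff_succ_iff_deriv]
    refine ⟨fun ξ => (h ξ).differentiableAt, by simp, ?_⟩
    rw [e1, contDiff_one_iff_deriv]
    refine ⟨fun ξ => (h' ξ).differentiableAt, ?_⟩
    rw [e2]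
    fun_prop
  · rw [schrodingerOp, e1, e2]; ring

theorem eq_of_hasDerivAt_zero {E : Type*} [NormedAddCommGroup E] [NormedSpace ℝ E] {f : ℝ → E}
    (h : ∀ x, HasDerivAt f 0 x) (x y : ℝ) : f x = f y :=
  is_const_of_deriv_eq_zero (fun x => (h x).differentiableAt) (fun x => (h x).deriv) x y

/-- The Wronskian of two solutions of `y'' = Q y` is constant. -/
theorem wronskian_eq {Q y y' z z' : ℝ → ℂ} (hy : ∀ ξ, HasDerivAt y (y' ξ) ξ)
    (hy' : ∀ ξ, HasDerivAt y' (Q ξ * y ξ) ξ) (hz : ∀ ξ, HasDerivAt z (z' ξ) ξ)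
    (hz' : ∀ ξ, HasDerivAt z' (Q ξ * z ξ) ξ) (ξ η : ℝ) :
    y ξ * z' ξ - y' ξ * z ξ = y η * z' η - y' η * z η :=
  eq_of_hasDerivAt_zero (f := fun ξ => y ξ * z' ξ - y' ξ * z ξ)
    (fun x => (((hy x).mul (hz' x)).sub ((hy' x).mul (hz x))).congr_deriv (by ring)) ξ η

/-! ### The Liouville transform -/

namespace IsAcoustic

variable {ρ : ℝ → ℝ}

theorem exists_hasDerivAt_sqrt_rhoS (hρ : IsAcoustic ρ) :
    ∃ σ₁ σ₂ : ℝ → ℝ, IsSchwartz σ₁ ∧ IsSchwartz σ₂ ∧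
      (∀ ξ, HasDerivAt (fun ξ => √(_root_.rhoS ρ ξ)) (σ₁ ξ) ξ) ∧
      ∀ ξ, HasDerivAt σ₁ (σ₂ ξ) ξ := by
  obtain ⟨σ₁, h1, hd1⟩ := hρ.rhoS.sqrt.exists_hasDerivAt
  obtain ⟨σ₂, h2, hd2⟩ := h1.exists_hasDerivAt
  exact ⟨σ₁, σ₂, h1, h2, hd1, hd2⟩

/-- As `X' = σ⁻²`, the first derivative is `σ₁ f(X) + σ⁻¹ f'(X)`. On differentiating again, the two
terms `± σ₁ σ⁻² f'(X)` cancel, and the remaining `σ⁻³ f''(X)` is `σ · ρ_s⁻² f''(X)`. -/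
theorem deriv_deriv_liouvilleMap (hρ : IsAcoustic ρ) {σ₁ σ₂ : ℝ → ℝ}
    (h1 : ∀ ξ, HasDerivAt (fun ξ => √(_root_.rhoS ρ ξ)) (σ₁ ξ) ξ)
    (h2 : ∀ ξ, HasDerivAt σ₁ (σ₂ ξ) ξ) {f : ℝ → ℂ} (hf : ContDiff ℝ 2 f) (ξ : ℝ) :
    deriv (deriv (liouvilleMap ρ f)) ξ =
      σ₂ ξ * f (travelTimeInv ρ ξ) + liouvilleMap ρ (acousticOp ρ f) ξ := by
  set σ : ℝ → ℝ := fun ξ => √(_root_.rhoS ρ ξ) with hσ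
  set X := travelTimeInv ρ with hX
  have hσ0 : ∀ ξ, 0 < σ ξ := fun ξ => hρ.rhoS.sqrt.1 ξ
  have hσ2 : ∀ ξ, _root_.rhoS ρ ξ = σ ξ ^ 2 := fun ξ => (Real.sq_sqrt (hρ.rhoS.1 ξ).le).symm
  have hσc : ∀ ξ, (σ ξ : ℂ) ≠ 0 := fun ξ => Complex.ofReal_ne_zero.2 (hσ0 ξ).ne'
  have hX' : ∀ ξ, HasDerivAt X ((σ ξ ^ 2)⁻¹) ξ := fun ξ => by
    have := hρ.hasDerivAt_travelTimeInv ξ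
    rwa [hσ2, one_div] at this
  have hf1 : ContDiff ℝ 1 (deriv f) := hf.deriv' (n := 1)
  have d0 : ∀ x, HasDerivAt f (deriv f x) x :=
    fun x => (hf.differentiable two_ne_zero x).hasDerivAt
  have d1 : ∀ x, HasDerivAt (deriv f) (deriv (deriv f) x) x :=
    fun x => (hf1.differentiable one_ne_zero x).hasDerivAt
  have e1 : deriv (liouvilleMap ρ f) =
      fun ξ => (σ₁ ξ : ℂ) * f (X ξ) + (σ ξ : ℂ)⁻¹ * deriv f (X ξ) := by
    funext ξ
    refine (((h1 ξ).ofReal_comp.mul ((d0 (X ξ)).scomp ξ (hX' ξ))).congr_deriv ?_).deriv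
    have := hσc ξ
    simp only [Complex.real_smul, Function.comp]
    push_cast
    field_simp
  have e2 := ((h2 ξ).ofReal_comp.mul ((d0 (X ξ)).scomp ξ (hX' ξ))).add
    (((h1 ξ).ofReal_comp.inv (hσc ξ)).mul ((d1 (X ξ)).scomp ξ (hX' ξ)))
  rw [e1]
  refine (e2.congr_deriv ?_).deriv
  have := hσc ξ
  have h4 : ρ (X ξ) = σ ξ ^ 2 := hσ2 ξ
  simp only [Complex.real_smul, Function.comp, Pi.inv_apply, liouvilleMap, acousticOp, ← hX, h4,
    show √(_root_.rhoS ρ ξ) = σ ξ from rfl]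
  push_cast
  field_simp
  ring

theorem isLiouvilleTransform_iff (hρ : IsAcoustic ρ) {σ₁ σ₂ : ℝ → ℝ}
    (h1 : ∀ ξ, HasDerivAt (fun ξ => √(_root_.rhoS ρ ξ)) (σ₁ ξ) ξ)
    (h2 : ∀ ξ, HasDerivAt σ₁ (σ₂ ξ) ξ) (q : ℝ → ℝ) :
    IsLiouvilleTransform ρ q ↔ ∀ ξ, σ₂ ξ = q ξ * √(_root_.rhoS ρ ξ) := by
  constructor
  · intro h ξ
    -- The constant `1` is annihilated by the acoustic operator and is mapped to `√ρ_s`.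
    have h3 := congrFun (h (fun _ => 1) contDiff_const) ξ
    rw [schrodingerOp, hρ.deriv_deriv_liouvilleMap h1 h2 contDiff_const] at h3
    have h4 : (σ₂ ξ : ℂ) = q ξ * √(_root_.rhoS ρ ξ) := by
      simp only [liouvilleMap] at h3
      linear_combination -h3
    exact_mod_cast h4
  · intro h f hf
    funext ξ
    rw [schrodingerOp, hρ.deriv_deriv_liouvilleMap h1 h2 hf, h]
    simp only [liouvilleMap]
    push_cast
    ring

theorem existsUnique_isLiouvilleTransform (hρ : IsAcoustic ρ) :
    ∃! q : ℝ → ℝ, IsLiouvilleTransform ρ q := by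
  obtain ⟨σ₁, σ₂, -, -, h1, h2⟩ := hρ.exists_hasDerivAt_sqrt_rhoS
  have h0 : ∀ ξ, √(_root_.rhoS ρ ξ) ≠ 0 := fun ξ => (hρ.rhoS.sqrt.1 ξ).ne'
  refine ⟨fun ξ => σ₂ ξ / √(_root_.rhoS ρ ξ), ?_, fun q hq => ?_⟩
  · exact (hρ.isLiouvilleTransform_iff h1 h2 _).2 fun ξ => (div_mul_cancel₀ _ (h0 ξ)).symm
  · funext ξ
    rw [(hρ.isLiouvilleTransform_iff h1 h2 q).1 hq ξ, mul_div_cancel_right₀ _ (h0 ξ)]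

end IsAcoustic

/-- The square root of `ρ_s` solves the Schrödinger equation at zero energy. -/
theorem IsLiouvilleTransform.exists_hasDerivAt {ρ q : ℝ → ℝ} (hρ : IsAcoustic ρ)
    (hq : IsLiouvilleTransform ρ q) :
    ∃ σ₁ : ℝ → ℝ, IsSchwartz σ₁ ∧ (∀ ξ, HasDerivAt (fun ξ => √(rhoS ρ ξ)) (σ₁ ξ) ξ) ∧
      ∀ ξ, HasDerivAt σ₁ (q ξ * √(rhoS ρ ξ)) ξ := by
  obtain ⟨σ₁, σ₂, hs1, -, h1, h2⟩ := hρ.exists_hasDerivAt_sqrt_rhoS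
  exact ⟨σ₁, hs1, h1, fun ξ => (hρ.isLiouvilleTransform_iff h1 h2 q).1 hq ξ ▸ h2 ξ⟩

theorem IsLiouvilleTransform.isSchwartz {ρ q : ℝ → ℝ} (hρ : IsAcoustic ρ)
    (hq : IsLiouvilleTransform ρ q) : IsSchwartz q := by
  obtain ⟨σ₁, σ₂, -, hs, h1, h2⟩ := hρ.exists_hasDerivAt_sqrt_rhoS
  refine (hρ.rhoS.sqrt.mul_rpow hs (-1)).congr fun ξ => ?_
  have := (hρ.rhoS.sqrt.1 ξ).ne'
  rw [(hρ.isLiouvilleTransform_iff h1 h2 q).1 hq ξ, Real.rpow_neg_one]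
  field_simp

theorem IsAcoustic.tendsto_sqrt_rhoS {ρ : ℝ → ℝ} (hρ : IsAcoustic ρ) :
    Tendsto (fun ξ => √(_root_.rhoS ρ ξ)) (cocompact ℝ) (𝓝 1) :=
  hρ.rhoS.sqrt.tendsto_cocompact

theorem IsAcoustic.tendsto_travelTimeInv_atTop {ρ : ℝ → ℝ} (hρ : IsAcoustic ρ) :
    Tendsto (travelTimeInv ρ) atTop atTop := by
  refine tendsto_atTop_mono (fun x => ?_) (tendsto_atTop_add_const_right _
      (-∫ y, |ρ y - 1|) tendsto_id)
  have := (abs_le.1 (hρ.abs_travelTimeInv_sub_le x)).1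
  simp only [id]; linarith

/-- The wave function `ψ_s(·, 0)` of a Liouville transform. -/
theorem IsLiouvilleTransform.isRightWave_zero_iff {ρ q : ℝ → ℝ} (hρ : IsAcoustic ρ)
    (hq : IsLiouvilleTransform ρ q) (χ : ℝ → ℂ) :
    IsRightWave q 0 χ ↔ χ = fun ξ => (√(rhoS ρ ξ) : ℂ) := by
  obtain ⟨σ₁, -, h1, h2⟩ := hq.exists_hasDerivAt hρ
  set σ : ℝ → ℝ := fun ξ => √(rhoS ρ ξ) with hσ
  have hlim : Tendsto (fun ξ => (σ ξ : ℂ)) atTop (𝓝 1) := by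
    have h := hρ.tendsto_sqrt_rhoS.mono_left atTop_le_cocompact
    exact (Complex.continuous_ofReal.tendsto 1).comp h
  have hσc : ∀ ξ, (σ ξ : ℂ) ≠ 0 := fun ξ => Complex.ofReal_ne_zero.2 (hρ.rhoS.sqrt.1 ξ).ne'
  constructor
  · rintro ⟨hw, hχ⟩
    have hχ1 : Tendsto χ atTop (𝓝 1) := by simpa using hχ
    obtain ⟨d1, d2⟩ := hw.hasDerivAt
    have hW := wronskian_eq (Q := fun ξ => (q ξ : ℂ)) (fun ξ => (h1 ξ).ofReal_comp)
      (fun ξ => (h2 ξ).ofReal_comp.congr_deriv (by push_cast; rfl)) d1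
      (fun ξ => (d2 ξ).congr_deriv (by simp))
    set w : ℂ := σ 0 * deriv χ 0 - σ₁ 0 * χ 0 with hw0
    -- Reduction of order: `(χ/σ)' = w/σ² = w X'`, where `w` is the constant Wronskian.
    set F : ℝ → ℂ := fun ξ => χ ξ * (σ ξ : ℂ)⁻¹ - (travelTimeInv ρ ξ : ℂ) * w with hF
    have hFd : ∀ ξ, HasDerivAt F 0 ξ := by
      intro ξ
      refine (((d1 ξ).mul ((h1 ξ).ofReal_comp.inv (hσc ξ))).sub
        ((hρ.hasDerivAt_travelTimeInv ξ).ofReal_comp.mul_const w)).congr_deriv ?_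
      have h5 : (rhoS ρ ξ : ℂ) = (σ ξ : ℂ) ^ 2 := by
        exact_mod_cast (Real.sq_sqrt (hρ.rhoS.1 ξ).le).symm
      have := hσc ξ
      have h6 := hW ξ 0
      rw [← hw0] at h6
      rw [← h6]
      push_cast
      rw [h5]
      simp only [Pi.inv_apply]
      field_simp
      ring
    have hconst := eq_of_hasDerivAt_zero hFd
    have hdiv : Tendsto (fun ξ => χ ξ * (σ ξ : ℂ)⁻¹) atTop (𝓝 1) := by
      simpa using hχ1.mul (hlim.inv₀ one_ne_zero)
    -- `χ/σ` converges while `X → ∞`, so the multiple of the second solution `σ X` must vanish.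
    have hw1 : w = 0 := by
      have hX : Tendsto (fun ξ => ((travelTimeInv ρ ξ : ℂ))⁻¹) atTop (𝓝 0) := by
        have := tendsto_inv_atTop_zero.comp hρ.tendsto_travelTimeInv_atTop
        have h7 := (Complex.continuous_ofReal.tendsto 0).comp this
        simpa [Function.comp_def] using h7
      have h8 := hX.mul (hdiv.sub (tendsto_const_nhds (x := F 0)))
      rw [zero_mul] at h8
      refine tendsto_nhds_unique (h8.congr' ?_ ) tendsto_const_nhds |>.symm
      filter_upwards [hρ.tendsto_travelTimeInv_atTop.eventually_gt_atTop 0] with ξ hξ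
      have : (travelTimeInv ρ ξ : ℂ) ≠ 0 := Complex.ofReal_ne_zero.2 hξ.ne'
      rw [← hconst ξ 0, hF]
      field_simp
      ring
    have hone : F 0 = 1 := by
      refine tendsto_nhds_unique (tendsto_const_nhds (x := F 0) (f := atTop (α := ℝ))) ?_
      refine hdiv.congr fun ξ => ?_
      rw [← hconst ξ 0, hF, hw1]
      simp
    funext ξ
    have := hconst ξ 0
    rw [hone, hF, hw1] at this
    simp only [mul_zero, sub_zero] at this
    exact (mul_inv_eq_one₀ (hσc ξ)).1 this
  · rintro rfl
    refine ⟨IsWave.of_hasDerivAt (hq.isSchwartz hρ).continuous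
      (fun ξ => (h1 ξ).ofReal_comp) (fun ξ => (h2 ξ).ofReal_comp.congr_deriv ?_), ?_⟩
    · simp
    · simpa using hlim

/-! ### Absence of bound states -/

theorem not_integrable_of_le_Ici {g : ℝ → ℝ} (hg : Integrable g) {ε c : ℝ} (hε : 0 < ε)
    (h : ∀ x, c ≤ x → ε ≤ g x) : False := by
  have h1 : IntegrableOn (fun _ : ℝ => ε) (Set.Ici c) := by
    refine Integrable.mono' (hg.integrableOn (s := Set.Ici c)) aestronglyMeasurable_const ?_
    refine (ae_restrict_iff' measurableSet_Ici).2 (Eventually.of_forall fun x hx => ?_)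
    rw [Real.norm_eq_abs, abs_of_pos hε]
    exact h x hx
  rw [integrableOn_const_iff] at h1
  simp [hε.ne'] at h1

/-- A real solution of `u'' = (q + ω²) u` cannot be square integrable if `σ'' = q σ` has a solution
bounded and bounded away from `0`. -/
theorem eq_zero_of_sq_integrable {q σ σ₁ u u₁ G : ℝ → ℝ} {ω δ K : ℝ} (hω : 0 < ω) (hδ : 0 < δ)
    (hb : ∀ ξ, δ ≤ σ ξ ∧ σ ξ ≤ K) (h1 : ∀ ξ, HasDerivAt σ (σ₁ ξ) ξ)
    (h2 : ∀ ξ, HasDerivAt σ₁ (q ξ * σ ξ) ξ) (hu1 : ∀ ξ, HasDerivAt u (u₁ ξ) ξ)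
    (hu2 : ∀ ξ, HasDerivAt u₁ ((q ξ + ω ^ 2) * u ξ) ξ) (hG : Integrable G)
    (huG : ∀ ξ, u ξ ^ 2 ≤ G ξ) (ξ : ℝ) : u ξ = 0 := by
  have hpos : ∀ ξ, 0 < σ ξ := fun ξ => hδ.trans_le (hb ξ).1
  have hne : ∀ ξ, σ ξ ≠ 0 := fun ξ => (hpos ξ).ne'
  -- `B = σ² (u/σ)(u/σ)'`. Subtracting the logarithmic derivative of `σ` removes `q` from `B'`,
  -- which becomes a sum of squares.
  set B : ℝ → ℝ := fun ξ => u ξ * u₁ ξ - σ₁ ξ * (σ ξ)⁻¹ * u ξ ^ 2 with hB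
  have hBd : ∀ ξ, HasDerivAt B ((u₁ ξ - σ₁ ξ * (σ ξ)⁻¹ * u ξ) ^ 2 + ω ^ 2 * u ξ ^ 2) ξ := by
    intro ξ
    refine (((hu1 ξ).mul (hu2 ξ)).sub (((h2 ξ).mul ((h1 ξ).inv (hne ξ))).mul
      ((hu1 ξ).pow 2))).congr_deriv ?_
    have := hne ξ
    simp only [Pi.mul_apply, Pi.inv_apply, Pi.pow_apply]
    field_simp
    ring
  have hmono : Monotone B := monotone_of_deriv_nonneg (fun ξ => (hBd ξ).differentiableAt)
    fun ξ => by rw [(hBd ξ).deriv]; positivity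
  set H : ℝ → ℝ := fun ξ => u ξ ^ 2 * (σ ξ ^ 2)⁻¹ with hH
  have hHd : ∀ ξ, HasDerivAt H (2 * B ξ * (σ ξ ^ 2)⁻¹) ξ := by
    intro ξ
    refine (((hu1 ξ).pow 2).mul (((h1 ξ).pow 2).inv (pow_ne_zero 2 (hne ξ)))).congr_deriv ?_
    have := hne ξ
    simp only [hB, Pi.pow_apply, Pi.inv_apply]
    field_simp
    ring
  have hK : 0 < K := (hpos 0).trans_le (hb 0).2
  have hH0 : ∀ ξ, 0 ≤ H ξ := fun ξ => by positivity
  have hHG : ∀ ξ, δ ^ 2 * H ξ ≤ G ξ := by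
    intro ξ
    refine le_trans ?_ (huG ξ)
    rw [hH]
    have h3 : δ ^ 2 * (σ ξ ^ 2)⁻¹ ≤ 1 := by
      rw [← div_eq_mul_inv, div_le_one (pow_pos (hpos ξ) 2)]
      exact pow_le_pow_left₀ hδ.le (hb ξ).1 2
    nlinarith [sq_nonneg (u ξ)]
  have hσK : ∀ ξ, (K ^ 2)⁻¹ ≤ (σ ξ ^ 2)⁻¹ := fun ξ =>
    inv_anti₀ (pow_pos (hpos ξ) 2) (pow_le_pow_left₀ (hpos ξ).le (hb ξ).2 2)
  have hcont : Continuous H := continuous_iff_continuousAt.2 fun ξ => (hHd ξ).continuousAt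
  -- `H = (u/σ)²` has `H' = 2B/σ²`. By monotonicity of `B`, a nonzero `B c` would make `H` grow at
  -- least linearly towards `-∞` or `+∞`, according to its sign; the unit margin beyond `c` turns
  -- this into a positive lower bound on a half-line.
  have hB0 : ∀ c, B c = 0 := by
    intro c
    rcases lt_trichotomy (B c) 0 with hc | hc | hc
    · exfalso
      set ε := 2 * (-B c) * (K ^ 2)⁻¹ with hε
      have hε0 : 0 < ε := by have := neg_pos.2 hc; positivity
      refine not_integrable_of_le_Ici (c := 1 - c) hG.comp_neg
        (show 0 < δ ^ 2 * ε by positivity) fun x hx => le_trans ?_ (hHG (-x))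
      have h4 : H c - H (-x) ≤ -ε * (c - -x) := by
        refine (convex_Iic c).image_sub_le_mul_sub_of_deriv_le hcont.continuousOn
          (fun y _ => (hHd y).differentiableAt.differentiableWithinAt) (fun y hy => ?_)
          _ (by simp; linarith) _ (Set.self_mem_Iic) (by linarith)
        rw [interior_Iic] at hy
        rw [(hHd y).deriv, hε]
        have h5 := hmono (le_of_lt hy)
        have h6 : 2 * (-B c) * (K ^ 2)⁻¹ ≤ 2 * (-B y) * (σ y ^ 2)⁻¹ :=
          mul_le_mul (by linarith) (hσK y) (by positivity) (by linarith)
        linarith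
      have h6 := hH0 c
      gcongr
      nlinarith
    · exact hc
    · exfalso
      set ε := 2 * B c * (K ^ 2)⁻¹ with hε
      have hε0 : 0 < ε := by positivity
      refine not_integrable_of_le_Ici (c := c + 1) hG
        (show 0 < δ ^ 2 * ε by positivity) fun x hx => le_trans ?_ (hHG x)
      have h4 : ε * (x - c) ≤ H x - H c := by
        refine (convex_Ici c).mul_sub_le_image_sub_of_le_deriv hcont.continuousOn
          (fun y _ => (hHd y).differentiableAt.differentiableWithinAt) (fun y hy => ?_)
          _ (Set.self_mem_Ici) _ (by simp; linarith) (by linarith)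
        rw [interior_Ici] at hy
        rw [(hHd y).deriv, hε]
        have h5 := hmono (le_of_lt hy)
        exact mul_le_mul (by linarith) (hσK y) (by positivity) (by linarith)
      have h6 := hH0 c
      gcongr
      nlinarith
  have h7 : (u₁ ξ - σ₁ ξ * (σ ξ)⁻¹ * u ξ) ^ 2 + ω ^ 2 * u ξ ^ 2 = 0 := by
    have h8 : HasDerivAt B 0 ξ := by rw [funext hB0]; exact hasDerivAt_const ξ 0
    exact (hBd ξ).unique h8
  have h9 : ω ^ 2 * u ξ ^ 2 = 0 := by
    nlinarith [sq_nonneg (u₁ ξ - σ₁ ξ * (σ ξ)⁻¹ * u ξ), mul_nonneg (sq_nonneg ω) (sq_nonneg (u ξ))]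
  exact pow_eq_zero_iff two_ne_zero |>.1 ((mul_eq_zero.1 h9).resolve_left (pow_ne_zero 2 hω.ne'))

theorem IsLiouvilleTransform.not_hasBoundState {ρ q : ℝ → ℝ} (hρ : IsAcoustic ρ)
    (hq : IsLiouvilleTransform ρ q) : ¬ HasBoundState q := by
  rintro ⟨ω, hω, ψ, hψ0, hψ, hL⟩
  obtain ⟨σ₁, -, h1, h2⟩ := hq.exists_hasDerivAt hρ
  obtain ⟨δ, K, hδ, hb⟩ := hρ.rhoS.sqrt.exists_bounds
  obtain ⟨d1, d2⟩ := hψ.hasDerivAt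
  have hG : Integrable fun ξ => ‖ψ ξ‖ ^ 2 := (memLp_two_iff_integrable_sq_norm hL.1).1 hL
  have d2' : ∀ ξ, HasDerivAt (deriv ψ) (((q ξ + ω ^ 2 : ℝ) : ℂ) * ψ ξ) ξ := fun ξ => by
    refine (d2 ξ).congr_deriv ?_
    rw [mul_pow, Complex.I_sq]; push_cast; ring
  have hre := eq_zero_of_sq_integrable (u := fun ξ => (ψ ξ).re) hω hδ hb h1 h2
    (fun ξ => Complex.reCLM.hasFDerivAt.comp_hasDerivAt ξ (d1 ξ))
    (fun ξ => (Complex.reCLM.hasFDerivAt.comp_hasDerivAt ξ (d2' ξ)).congr_deriv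
      (by rw [Complex.reCLM_apply, Complex.re_ofReal_mul])) hG
    (fun ξ => by rw [← sq_abs]; gcongr; exact Complex.abs_re_le_norm _)
  have him := eq_zero_of_sq_integrable (u := fun ξ => (ψ ξ).im) hω hδ hb h1 h2
    (fun ξ => Complex.imCLM.hasFDerivAt.comp_hasDerivAt ξ (d1 ξ))
    (fun ξ => (Complex.imCLM.hasFDerivAt.comp_hasDerivAt ξ (d2' ξ)).congr_deriv
      (by rw [Complex.imCLM_apply, Complex.im_ofReal_mul])) hG
    (fun ξ => by rw [← sq_abs]; gcongr; exact Complex.abs_im_le_norm _)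
  exact hψ0 (funext fun ξ => Complex.ext (hre ξ) (him ξ))

/-! ### A Volterra equation on the line with parameters -/

/-- The integrand has antiderivative `-½ exp(-2c arctan y)`. The resulting factor `1/2` is the
contraction constant for the Volterra operator in the weighted norm. -/
theorem integral_Ioi_mul_exp_arctan_le {c : ℝ} (hc : 0 < c) (ξ : ℝ) :
    IntegrableOn (fun y => c * (1 + y ^ 2)⁻¹ * Real.exp (-(2 * c) * Real.arctan y)) (Set.Ioi ξ) ∧
    ∫ y in Set.Ioi ξ, c * (1 + y ^ 2)⁻¹ * Real.exp (-(2 * c) * Real.arctan y) ≤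
      1 / 2 * Real.exp (-(2 * c) * Real.arctan ξ) := by
  have hd : ∀ y ∈ Set.Ici ξ, HasDerivAt
      (fun y => -(1 / 2) * Real.exp (-(2 * c) * Real.arctan y))
      (c * (1 + y ^ 2)⁻¹ * Real.exp (-(2 * c) * Real.arctan y)) y := fun y _ => by
    refine ((((Real.hasDerivAt_arctan y).const_mul (-(2 * c))).exp).const_mul
      (-(1 / 2))).congr_deriv ?_
    ring
  have hl : Tendsto (fun y => -(1 / 2) * Real.exp (-(2 * c) * Real.arctan y)) atTop
      (𝓝 (-(1 / 2) * Real.exp (-(2 * c) * (Real.pi / 2)))) := by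
    have h := (Real.tendsto_arctan_atTop.mono_right nhdsWithin_le_nhds).const_mul (-(2 * c))
    exact ((Real.continuous_exp.tendsto _).comp h).const_mul _
  have hp : ∀ y ∈ Set.Ioi ξ, 0 ≤ c * (1 + y ^ 2)⁻¹ * Real.exp (-(2 * c) * Real.arctan y) :=
    fun y _ => by positivity
  refine ⟨integrableOn_Ioi_deriv_of_nonneg' hd hp hl, ?_⟩
  rw [integral_Ioi_of_hasDerivAt_of_nonneg' hd hp hl]
  have := Real.exp_pos (-(2 * c) * (Real.pi / 2))
  linarith

/-- Writing `u = E v` with `E ξ = exp(-2c arctan ξ)` turns the equation into a fixed point problem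
with contraction constant `1/2`, whatever the size of `c`. This relies on the kernel being supported
in `y > ξ`. The fixed point is sought among bounded continuous functions on `P × ℝ`, which gives
joint continuity in the parameter at once. -/
theorem exists_volterra {P : Type*} [TopologicalSpace P] [FirstCountableTopology P]
    {K : P × ℝ → ℝ → ℂ}
    (hK : Continuous (Function.uncurry K)) {c : ℝ} (hc : 0 < c)
    (h0 : ∀ p ξ y, y ≤ ξ → K (p, ξ) y = 0) (hb : ∀ x y, ‖K x y‖ ≤ c * (1 + y ^ 2)⁻¹)
    {f : P × ℝ → ℂ} (hf : Continuous f) {A : ℝ} (hfb : ∀ x, ‖f x‖ ≤ A) :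
    ∃ u : P × ℝ → ℂ, Continuous u ∧ (∃ M, ∀ x, ‖u x‖ ≤ M) ∧
      ∀ p ξ, u (p, ξ) = f (p, ξ) + ∫ y, K (p, ξ) y * u (p, y) := by
  set E : ℝ → ℝ := fun ξ => Real.exp (-(2 * c) * Real.arctan ξ) with hE
  have hEc : Continuous E := by fun_prop
  have hE0 : ∀ ξ, 0 < E ξ := fun ξ => Real.exp_pos _
  have hEle : ∀ ξ, E ξ ≤ Real.exp (c * Real.pi) := fun ξ =>
    Real.exp_le_exp.2 (by nlinarith [Real.neg_pi_div_two_lt_arctan ξ])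
  have hEinv : ∀ ξ, (E ξ)⁻¹ ≤ Real.exp (c * Real.pi) := fun ξ => by
    rw [hE, ← Real.exp_neg]
    exact Real.exp_le_exp.2 (by nlinarith [Real.arctan_lt_pi_div_two ξ])
  have hEcn : ∀ ξ, (E ξ : ℂ) ≠ 0 := fun ξ => Complex.ofReal_ne_zero.2 (hE0 ξ).ne'
  have hfc : ∀ (p : P) (ξ : ℝ), Continuous (K (p, ξ)) := fun p ξ =>
    hK.comp (by fun_prop : Continuous fun y : ℝ => ((p, ξ), y))
  have hbd : ∀ (v : BoundedContinuousFunction (P × ℝ) ℂ) (x : P × ℝ) (y : ℝ),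
      ‖K x y * (E y * v (x.1, y))‖ ≤
        (1 + y ^ 2)⁻¹ * (c * (Real.exp (c * Real.pi) * ‖v‖)) := by
    intro v x y
    rw [norm_mul, norm_mul, Complex.norm_of_nonneg (hE0 y).le]
    calc ‖K x y‖ * (E y * ‖v (x.1, y)‖)
        ≤ (c * (1 + y ^ 2)⁻¹) * (Real.exp (c * Real.pi) * ‖v‖) := by
          gcongr
          exacts [hb x y, hEle y, v.norm_coe_le_norm _]
      _ = _ := by ring
  have hmeas : ∀ (v : BoundedContinuousFunction (P × ℝ) ℂ) (x : P × ℝ),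
      Continuous fun y => K x y * (E y * v (x.1, y)) := by
    intro v x
    have := hfc x.1 x.2
    have := v.continuous
    fun_prop
  have hint : ∀ (v : BoundedContinuousFunction (P × ℝ) ℂ) (x : P × ℝ),
      Integrable fun y => K x y * (E y * v (x.1, y)) := fun v x =>
    Integrable.mono' (integrable_inv_one_add_sq.mul_const _) (hmeas v x).aestronglyMeasurable
      (Eventually.of_forall (hbd v x))
  have hcont : ∀ v : BoundedContinuousFunction (P × ℝ) ℂ,
      Continuous fun x : P × ℝ => ∫ y, K x y * (E y * v (x.1, y)) := by
    intro v
    refine continuous_of_dominated (fun x => (hmeas v x).aestronglyMeasurable)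
      (fun x => Eventually.of_forall (hbd v x)) (integrable_inv_one_add_sq.mul_const _)
      (Eventually.of_forall fun y => ?_)
    have h1 : Continuous fun x : P × ℝ => K x y :=
      hK.comp (by fun_prop : Continuous fun x : P × ℝ => (x, y))
    have := v.continuous
    fun_prop
  have hle : ∀ (v : BoundedContinuousFunction (P × ℝ) ℂ) (x : P × ℝ),
      ‖∫ y, K x y * (E y * v (x.1, y))‖ ≤ 1 / 2 * E x.2 * ‖v‖ := by
    rintro v ⟨p, ξ⟩
    obtain ⟨hi, hI⟩ := integral_Ioi_mul_exp_arctan_le hc ξ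
    rw [← setIntegral_eq_integral_of_forall_compl_eq_zero (s := Set.Ioi ξ)
      (fun y hy => by rw [h0 p ξ y (not_lt.1 hy), zero_mul])]
    refine (norm_integral_le_of_norm_le (hi.mul_const ‖v‖)
      (Eventually.of_forall fun y => ?_)).trans ?_
    · rw [norm_mul, norm_mul, Complex.norm_of_nonneg (hE0 y).le, ← mul_assoc]
      gcongr
      exacts [hb _ y, v.norm_coe_le_norm _]
    · rw [integral_mul_const]
      gcongr
  have hΦb : ∀ (v : BoundedContinuousFunction (P × ℝ) ℂ) (x : P × ℝ),
      ‖((E x.2 : ℂ))⁻¹ * (f x + ∫ y, K x y * (E y * v (x.1, y)))‖ ≤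
        Real.exp (c * Real.pi) * (A + 1 / 2 * Real.exp (c * Real.pi) * ‖v‖) := by
    intro v x
    rw [norm_mul, norm_inv, Complex.norm_of_nonneg (hE0 _).le]
    have hA : 0 ≤ A := (norm_nonneg _).trans (hfb x)
    gcongr
    · exact hEinv _
    · refine (norm_add_le _ _).trans (add_le_add (hfb x) ((hle v x).trans ?_))
      gcongr
      exact hEle _
  let Φ : BoundedContinuousFunction (P × ℝ) ℂ → BoundedContinuousFunction (P × ℝ) ℂ := fun v =>
    BoundedContinuousFunction.ofNormedAddCommGroup
      (fun x => ((E x.2 : ℂ))⁻¹ * (f x + ∫ y, K x y * (E y * v (x.1, y))))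
      (by
        have h1 : Continuous fun x : P × ℝ => ((E x.2 : ℂ))⁻¹ :=
          (by fun_prop : Continuous fun x : P × ℝ => (E x.2 : ℂ)).inv₀ fun x => hEcn x.2
        exact h1.mul (hf.add (hcont v))) _ (hΦb v)
  have hΦ : ContractingWith (1 / 2) Φ := by
    refine ⟨by norm_num, LipschitzWith.of_dist_le_mul fun v w => ?_⟩
    rw [dist_eq_norm, dist_eq_norm]
    refine (BoundedContinuousFunction.norm_le (by positivity)).2 fun x => ?_
    have h1 : (Φ v - Φ w) x = ((E x.2 : ℂ))⁻¹ * ∫ y, K x y * (E y * (v - w) (x.1, y)) := by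
      have h2 : ∫ y, K x y * (E y * (v - w) (x.1, y)) =
          (∫ y, K x y * (E y * v (x.1, y))) - ∫ y, K x y * (E y * w (x.1, y)) := by
        rw [← integral_sub (hint v x) (hint w x)]
        congr 1
        funext y
        simp only [BoundedContinuousFunction.coe_sub, Pi.sub_apply]
        ring
      rw [h2]
      simp only [Φ, BoundedContinuousFunction.coe_sub, Pi.sub_apply,
        BoundedContinuousFunction.coe_ofNormedAddCommGroup]
      ring
    rw [h1, norm_mul, norm_inv, Complex.norm_of_nonneg (hE0 _).le]
    calc (E x.2)⁻¹ * ‖∫ y, K x y * (E y * (v - w) (x.1, y))‖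
        ≤ (E x.2)⁻¹ * (1 / 2 * E x.2 * ‖v - w‖) := by
          gcongr
          exact hle _ x
      _ = 1 / 2 * ‖v - w‖ := by have := (hE0 x.2).ne'; field_simp
      _ = _ := by simp
  set v := ContractingWith.fixedPoint Φ hΦ with hv
  have hfix : Φ v = v := hΦ.fixedPoint_isFixedPt
  refine ⟨fun x => E x.2 * v x, ?_, ⟨Real.exp (c * Real.pi) * ‖v‖, fun x => ?_⟩, fun p ξ => ?_⟩
  · have := v.continuous
    fun_prop
  · rw [norm_mul, Complex.norm_of_nonneg (hE0 _).le]
    gcongr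
    exacts [hEle _, v.norm_coe_le_norm _]
  · have h1 : v (p, ξ) = ((E ξ : ℂ))⁻¹ * (f (p, ξ) + ∫ y, K (p, ξ) y * (E y * v (p, y))) :=
      (DFunLike.congr_fun hfix (p, ξ)).symm
    show (E ξ : ℂ) * v (p, ξ) = f (p, ξ) + ∫ y, K (p, ξ) y * (E y * v (p, y))
    rw [h1, ← mul_assoc, mul_inv_cancel₀ (hEcn ξ), one_mul]

/-! ### The function `(e^z - 1) / z` -/

/-- The entire function `(e^z - 1) / z`. -/
noncomputable def expSlope (z : ℂ) : ℂ := ∫ s in (0 : ℝ)..1, Complex.exp (z * s)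

theorem continuous_expSlope : Continuous expSlope :=
  intervalIntegral.continuous_parametric_intervalIntegral_of_continuous' (by fun_prop) 0 1

theorem norm_expSlope_le {z : ℂ} (hz : z.re ≤ 0) : ‖expSlope z‖ ≤ 1 := by
  have h := intervalIntegral.norm_integral_le_of_norm_le_const (a := (0 : ℝ)) (b := 1) (C := 1)
    (f := fun s : ℝ => Complex.exp (z * s)) (fun s hs => ?_)
  · simpa [expSlope] using h
  · rw [Set.uIoc_of_le zero_le_one] at hs
    rw [Complex.norm_exp, Complex.re_mul_ofReal]
    exact Real.exp_le_one_iff.2 (mul_nonpos_of_nonpos_of_nonneg hz hs.1.le)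

theorem mul_expSlope (z : ℂ) : z * expSlope z = Complex.exp z - 1 := by
  rcases eq_or_ne z 0 with rfl | hz
  · simp
  · rw [expSlope, integral_exp_mul_complex hz]
    simp; field_simp

theorem expSlope_zero : expSlope 0 = 1 := by simp [expSlope]

theorem hasDerivAt_integral_Ioi {h : ℝ → ℂ} (hc : Continuous h)
    (hi : ∀ a, IntegrableOn h (Set.Ioi a)) (ξ : ℝ) :
    HasDerivAt (fun ξ => ∫ y in Set.Ioi ξ, h y) (-h ξ) ξ := by
  have h1 : (fun ξ => ∫ y in Set.Ioi ξ, h y) =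
      fun ξ => (∫ y in Set.Ioi 0, h y) - ∫ y in (0 : ℝ)..ξ, h y := by
    funext ξ
    rw [← intervalIntegral.integral_Ioi_sub_Ioi' (hi 0) (hi ξ)]
    ring
  rw [h1]
  exact ((hc.integral_hasStrictDerivAt 0 ξ).hasDerivAt.const_sub _)

/-! ### Jost solutions -/

/-- The closed upper half plane. -/
abbrev ClosedUpperHalfPlane := {k : ℂ // 0 ≤ k.im}

/-- The solutions `e^{ikξ} m(k, ξ)` of `ψ'' = (q - k²) ψ` with `m → 1` at `+∞`, for `Im k ≥ 0`,
together with `n = m'`. -/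
structure JostSolution (q : ℝ → ℝ) where
  m : ClosedUpperHalfPlane → ℝ → ℂ
  n : ClosedUpperHalfPlane → ℝ → ℂ
  M : ℝ
  continuous_m : Continuous (Function.uncurry m)
  continuous_n : ∀ ξ, Continuous fun k => n k ξ
  hasDerivAt_m : ∀ k ξ, HasDerivAt (m k) (n k ξ) ξ
  hasDerivAt_n : ∀ k ξ, HasDerivAt (n k) (-(2 * Complex.I * k * n k ξ) + q ξ * m k ξ) ξ
  norm_m_sub_one_le : ∀ k ξ, 0 ≤ ξ → ‖m k ξ - 1‖ ≤ M * (1 + ξ ^ 2)⁻¹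
  norm_n_le : ∀ k ξ, 0 ≤ ξ → ‖n k ξ‖ ≤ M * (1 + ξ ^ 2)⁻¹

/-- The kernel is `(e^{2ik(y-ξ)} - 1)/(2ik)`, written with `expSlope` so that `k = 0` is not
exceptional. Since `|expSlope| ≤ 1` on the left half plane, bounds are uniform in `k`. The kernel
can grow linearly in `|ξ|` as `ξ → -∞`, so the bounded unknown is `m/(1 + ξ²)`. -/
theorem exists_volterra_jost {q : ℝ → ℝ} (hq : Continuous q) {C : ℝ}
    (hC : ∀ y, |q y| * (1 + y ^ 2) ^ 4 ≤ C) :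
    ∃ (m : ClosedUpperHalfPlane → ℝ → ℂ) (M : ℝ), Continuous (Function.uncurry m) ∧ 0 ≤ M ∧
      (∀ k ξ, ‖m k ξ‖ ≤ M * (1 + ξ ^ 2)) ∧
      ∀ k ξ, m k ξ = 1 + ∫ y in Set.Ioi ξ, ((y - ξ : ℝ) : ℂ) *
        expSlope (2 * Complex.I * k * (y - ξ : ℝ)) * (q y * m k y) := by
  have hpos : ∀ x : ℝ, 0 < 1 + x ^ 2 := fun x => by positivity
  have hne : ∀ x : ℝ, ((1 + x ^ 2 : ℝ) : ℂ) ≠ 0 := fun x =>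
    Complex.ofReal_ne_zero.2 (hpos x).ne'
  have hC0 : 0 ≤ C := le_trans (by positivity) (hC 0)
  -- The positive part of `y - ξ` extends the kernel continuously by zero to `y ≤ ξ`; the factors `1
  -- + y²` and `(1 + ξ²)⁻¹` conjugate by the weight.
  let K : ClosedUpperHalfPlane × ℝ → ℝ → ℂ := fun x y =>
    ((max (y - x.2) 0 : ℝ) : ℂ) *
      expSlope (2 * Complex.I * (x.1 : ℂ) * (max (y - x.2) 0 : ℝ)) *
      (q y * ((1 + y ^ 2 : ℝ) : ℂ)) * ((1 + x.2 ^ 2 : ℝ) : ℂ)⁻¹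
  have hKc : Continuous (Function.uncurry K) := by
    have h1 : Continuous fun z : (ClosedUpperHalfPlane × ℝ) × ℝ =>
        expSlope (2 * Complex.I * (z.1.1 : ℂ) * (max (z.2 - z.1.2) 0 : ℝ)) :=
      continuous_expSlope.comp (by fun_prop)
    have h2 : Continuous fun z : (ClosedUpperHalfPlane × ℝ) × ℝ =>
        ((1 + z.1.2 ^ 2 : ℝ) : ℂ)⁻¹ :=
      (by fun_prop : Continuous fun z : (ClosedUpperHalfPlane × ℝ) × ℝ =>
        ((1 + z.1.2 ^ 2 : ℝ) : ℂ)).inv₀ fun z => hne _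
    have h3 : Continuous fun z : (ClosedUpperHalfPlane × ℝ) × ℝ =>
        ((max (z.2 - z.1.2) 0 : ℝ) : ℂ) := by fun_prop
    have h4 : Continuous fun z : (ClosedUpperHalfPlane × ℝ) × ℝ =>
        ((q z.2 : ℂ) * ((1 + z.2 ^ 2 : ℝ) : ℂ)) := by fun_prop
    exact ((h3.mul h1).mul h4).mul h2
  have hφ : ∀ (k : ClosedUpperHalfPlane) (t : ℝ), 0 ≤ t →
      ‖expSlope (2 * Complex.I * (k : ℂ) * (t : ℝ))‖ ≤ 1 := fun k t ht => by
    refine norm_expSlope_le ?_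
    have h : (2 * Complex.I * (k : ℂ) * (t : ℝ)).re = -(2 * (k : ℂ).im * t) := by
      simp [Complex.mul_re, Complex.mul_im]
    rw [h]
    have := k.2
    simp only [Left.neg_nonpos_iff]
    positivity
  obtain ⟨u, huc, ⟨M, hM⟩, hu⟩ := exists_volterra (K := K) hKc (c := 2 * C + 1) (by positivity)
    (fun p ξ y hy => by
      have : max (y - ξ) 0 = 0 := max_eq_right (by linarith)
      simp only [K, this]; simp)
    (fun x y => by
      obtain ⟨k, ξ⟩ := x
      have hmax : max (y - ξ) 0 ≤ 2 * (1 + y ^ 2) * (1 + ξ ^ 2) := by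
        refine max_le ?_ (by positivity)
        nlinarith [sq_nonneg (y - 1), sq_nonneg (ξ + 1), mul_nonneg (sq_nonneg y) (sq_nonneg ξ),
          sq_nonneg y, sq_nonneg ξ]
      simp only [K]
      rw [norm_mul, norm_mul, norm_mul, norm_mul, norm_inv,
        Complex.norm_of_nonneg (le_max_right (y - ξ) 0), Complex.norm_of_nonneg (hpos y).le,
        Complex.norm_of_nonneg (hpos ξ).le, Complex.norm_real, Real.norm_eq_abs]
      calc max (y - ξ) 0 * ‖expSlope (2 * Complex.I * (k : ℂ) * (max (y - ξ) 0 : ℝ))‖ *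
            (|q y| * (1 + y ^ 2)) * (1 + ξ ^ 2)⁻¹
          ≤ (2 * (1 + y ^ 2) * (1 + ξ ^ 2)) * 1 * (|q y| * (1 + y ^ 2)) * (1 + ξ ^ 2)⁻¹ := by
            gcongr
            exact hφ k _ (le_max_right _ _)
        _ = 2 * (|q y| * (1 + y ^ 2) ^ 3) * (1 + y ^ 2)⁻¹ := by
            have := (hpos y).ne'; have := (hpos ξ).ne'; field_simp
        _ ≤ 2 * (|q y| * (1 + y ^ 2) ^ 4) * (1 + y ^ 2)⁻¹ := by
            gcongr
            exacts [by nlinarith [sq_nonneg y], by norm_num]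
        _ ≤ (2 * C + 1) * (1 + y ^ 2)⁻¹ := by
            gcongr
            linarith [hC y])
    (f := fun x => ((1 + x.2 ^ 2 : ℝ) : ℂ)⁻¹)
    ((by fun_prop : Continuous fun x : ClosedUpperHalfPlane × ℝ =>
        ((1 + x.2 ^ 2 : ℝ) : ℂ)).inv₀ fun x => hne _) (A := 1)
    (fun x => by
      rw [norm_inv, Complex.norm_of_nonneg (hpos _).le]
      exact inv_le_one_of_one_le₀ (by nlinarith [sq_nonneg x.2]))
  refine ⟨fun k ξ => ((1 + ξ ^ 2 : ℝ) : ℂ) * u (k, ξ), M, ?_,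
    (norm_nonneg _).trans (hM (⟨0, le_rfl⟩, 0)), fun k ξ => ?_, fun k ξ => ?_⟩
  · exact (by fun_prop : Continuous fun z : ClosedUpperHalfPlane × ℝ =>
      ((1 + z.2 ^ 2 : ℝ) : ℂ)).mul huc
  · rw [norm_mul, Complex.norm_of_nonneg (hpos _).le, mul_comm]
    gcongr
    exact hM _
  · have h1 : ∫ y, K (k, ξ) y * u (k, y) =
        ((1 + ξ ^ 2 : ℝ) : ℂ)⁻¹ * ∫ y in Set.Ioi ξ, ((y - ξ : ℝ) : ℂ) *
        expSlope (2 * Complex.I * k * (y - ξ : ℝ)) *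
          (q y * (((1 + y ^ 2 : ℝ) : ℂ) * u (k, y))) := by
      rw [← setIntegral_eq_integral_of_forall_compl_eq_zero (s := Set.Ioi ξ) (fun y hy => by
        have : max (y - ξ) 0 = 0 := max_eq_right (sub_nonpos.2 (not_lt.1 hy))
        simp only [K, this]; simp), ← integral_const_mul]
      refine setIntegral_congr_fun measurableSet_Ioi fun y hy => ?_
      have : max (y - ξ) 0 = y - ξ := max_eq_left (sub_nonneg.2 (le_of_lt hy))
      simp only [K, this]
      ring
    show ((1 + ξ ^ 2 : ℝ) : ℂ) * u (k, ξ) = _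
    rw [hu, h1, mul_add, mul_inv_cancel₀ (hne ξ), ← mul_assoc, mul_inv_cancel₀ (hne ξ), one_mul]

theorem norm_exp_two_I_mul_le (k : ClosedUpperHalfPlane) {t : ℝ} (ht : 0 ≤ t) :
    ‖Complex.exp (2 * Complex.I * k * (t : ℝ))‖ ≤ 1 := by
  have h : (2 * Complex.I * (k : ℂ) * (t : ℝ)).re = -(2 * (k : ℂ).im * t) := by
    simp [Complex.mul_re, Complex.mul_im]
  rw [Complex.norm_exp, Real.exp_le_one_iff, h]
  have := k.2
  simp only [Left.neg_nonpos_iff]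
  positivity

/-- Factoring out `e^{-2ikξ}` leaves `ξ` only in the lower limit, so no differentiation under the
integral is needed. The factored integrand is integrable on every right half-line because `Im k ≥
0`. -/
theorem hasDerivAt_jost_deriv {k : ClosedUpperHalfPlane} {g : ℝ → ℂ} (hg : Continuous g)
    (hi : Integrable g) (ξ : ℝ) :
    HasDerivAt (fun ξ => -∫ y in Set.Ioi ξ, Complex.exp (2 * Complex.I * k * (y - ξ : ℝ)) * g y)
      (-(2 * Complex.I * k *
        -∫ y in Set.Ioi ξ, Complex.exp (2 * Complex.I * k * (y - ξ : ℝ)) * g y) + g ξ) ξ := by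
  have hfac : ∀ a y : ℝ, Complex.exp (2 * Complex.I * k * (y - a : ℝ)) * g y =
      Complex.exp (-(2 * Complex.I * k * a)) * (Complex.exp (2 * Complex.I * k * y) * g y) := by
    intro a y
    rw [← mul_assoc, ← Complex.exp_add]
    congr 2
    push_cast
    ring
  have hi' : ∀ a, IntegrableOn (fun y : ℝ => Complex.exp (2 * Complex.I * k * y) * g y)
      (Set.Ioi a) := by
    intro a
    refine Integrable.mono' ((hi.norm.const_mul
      ‖Complex.exp (2 * Complex.I * k * a)‖).integrableOn (s := Set.Ioi a))
      (by fun_prop : Continuous _).aestronglyMeasurable ?_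
    refine (ae_restrict_iff' measurableSet_Ioi).2 (Eventually.of_forall fun y hy => ?_)
    have h1 := norm_exp_two_I_mul_le k (sub_nonneg.2 (le_of_lt hy))
    have h2 : Complex.exp (2 * Complex.I * k * y) =
        Complex.exp (2 * Complex.I * k * a) * Complex.exp (2 * Complex.I * k * (y - a : ℝ)) := by
      rw [← Complex.exp_add]; congr 1; push_cast; ring
    rw [norm_mul, h2, norm_mul]
    gcongr
    exact mul_le_of_le_one_right (norm_nonneg _) h1
  have h1 := hasDerivAt_integral_Ioi (h := fun y : ℝ => Complex.exp (2 * Complex.I * k * y) * g y)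
    (by fun_prop) hi' ξ
  have h2 : HasDerivAt (fun a : ℝ => Complex.exp (-(2 * Complex.I * k * a)))
      (Complex.exp (-(2 * Complex.I * k * ξ)) * (-(2 * Complex.I * k * (1 : ℝ)))) ξ :=
    (((hasDerivAt_id ξ).ofReal_comp.const_mul (2 * Complex.I * (k : ℂ))).neg).cexp
  have h3 : ∀ a, ∫ y in Set.Ioi a, Complex.exp (2 * Complex.I * k * (y - a : ℝ)) * g y =
      Complex.exp (-(2 * Complex.I * k * a)) *
        ∫ y in Set.Ioi a, Complex.exp (2 * Complex.I * k * y) * g y := by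
    intro a
    rw [← integral_const_mul]
    simp only [hfac]
  simp only [h3]
  refine (h2.mul h1).neg.congr_deriv ?_
  have h4 : Complex.exp (-(2 * Complex.I * k * ξ)) * Complex.exp (2 * Complex.I * k * ξ) = 1 := by
    rw [← Complex.exp_add]; simp
  push_cast
  linear_combination g ξ * h4

/-- For `k = 0` the kernel is `y - ξ` and splits into two plain tail integrals; for `k ≠ 0` it is
`(e^{b(y-ξ)} - 1)/b` and reduces to the preceding derivative. -/
theorem hasDerivAt_jost {k : ClosedUpperHalfPlane} {g : ℝ → ℂ} (hg : Continuous g)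
    (hi : Integrable g) (hi1 : Integrable fun y : ℝ => (y : ℂ) * g y) (ξ : ℝ) :
    HasDerivAt (fun ξ => 1 + ∫ y in Set.Ioi ξ, ((y - ξ : ℝ) : ℂ) *
        expSlope (2 * Complex.I * k * (y - ξ : ℝ)) * g y)
      (-∫ y in Set.Ioi ξ, Complex.exp (2 * Complex.I * k * (y - ξ : ℝ)) * g y) ξ := by
  have h1 := hasDerivAt_integral_Ioi hg (fun a => hi.integrableOn) ξ
  rcases eq_or_ne (k : ℂ) 0 with hk | hk
  · have h2 := hasDerivAt_integral_Ioi (by fun_prop : Continuous fun y : ℝ => (y : ℂ) * g y)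
      (fun a => hi1.integrableOn) ξ
    have h3 : ∀ a : ℝ, 1 + ∫ y in Set.Ioi a, ((y - a : ℝ) : ℂ) *
        expSlope (2 * Complex.I * k * (y - a : ℝ)) * g y =
        1 + ((∫ y in Set.Ioi a, (y : ℂ) * g y) - a * ∫ y in Set.Ioi a, g y) := by
      intro a
      rw [← integral_const_mul, ← integral_sub hi1.integrableOn
        (hi.const_mul (a : ℂ)).integrableOn]
      simp only [hk, mul_zero, zero_mul, expSlope_zero, mul_one, Complex.ofReal_sub, sub_mul]
    simp only [h3]
    refine ((h2.sub ((hasDerivAt_id ξ).ofReal_comp.mul h1)).const_add 1).congr_deriv ?_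
    simp [hk]
  · set b := 2 * Complex.I * (k : ℂ) with hb
    have hb0 : b ≠ 0 := by simp [hb, hk]
    have h2 := (hasDerivAt_jost_deriv (k := k) hg hi ξ)
    have hie : ∀ a : ℝ, IntegrableOn (fun y => Complex.exp (b * (y - a : ℝ)) * g y)
        (Set.Ioi a) := by
      intro a
      refine Integrable.mono' (hi.norm.integrableOn (s := Set.Ioi a))
        (by fun_prop : Continuous _).aestronglyMeasurable ?_
      refine (ae_restrict_iff' measurableSet_Ioi).2 (Eventually.of_forall fun y hy => ?_)
      rw [norm_mul]
      exact mul_le_of_le_one_left (norm_nonneg _)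
        (norm_exp_two_I_mul_le k (sub_nonneg.2 (le_of_lt hy)))
    have h3 : ∀ a : ℝ, 1 + ∫ y in Set.Ioi a, ((y - a : ℝ) : ℂ) *
        expSlope (b * (y - a : ℝ)) * g y =
        1 + b⁻¹ * (-(-∫ y in Set.Ioi a, Complex.exp (b * (y - a : ℝ)) * g y) -
          ∫ y in Set.Ioi a, g y) := by
      intro a
      rw [neg_neg, ← integral_sub (hie a) hi.integrableOn, ← integral_const_mul]
      congr 2
      funext y
      have h4 := mul_expSlope (b * (y - a : ℝ))
      have h5 : ((y - a : ℝ) : ℂ) * expSlope (b * (y - a : ℝ)) =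
          b⁻¹ * (Complex.exp (b * (y - a : ℝ)) - 1) := by
        rw [← h4, ← mul_assoc, ← mul_assoc, inv_mul_cancel₀ hb0, one_mul]
      rw [h5]
      ring
    simp only [h3]
    refine (((h2.neg.sub h1).const_mul b⁻¹).const_add 1).congr_deriv ?_
    rw [← hb]
    field_simp
    ring

/-- The bound `M` does not depend on `k`. This uniformity drives both the limit `k → 0` of the
Wronskians and the positivity argument in `ω`. -/
theorem JostSolution.exists {q : ℝ → ℝ} (hq : Continuous q) {C : ℝ}
    (hC : ∀ y, |q y| * (1 + y ^ 2) ^ 4 ≤ C) : Nonempty (JostSolution q) := by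
  obtain ⟨m, M, hmc, hM0, hM, hm⟩ := exists_volterra_jost hq hC
  have hpos : ∀ x : ℝ, 0 < 1 + x ^ 2 := fun x => by positivity
  have hC0 : 0 ≤ C := le_trans (by positivity) (hC 0)
  have hgc : ∀ k, Continuous fun y => (q y : ℂ) * m k y := fun k => by
    have : Continuous (m k) := hmc.comp (by fun_prop : Continuous fun y : ℝ => (k, y))
    fun_prop
  have hgb : ∀ k y, ‖(q y : ℂ) * m k y‖ ≤ C * M * ((1 + y ^ 2)⁻¹ * ((1 + y ^ 2) ^ 2)⁻¹) := by
    intro k y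
    rw [norm_mul, Complex.norm_real, Real.norm_eq_abs]
    have h1 : |q y| ≤ C * ((1 + y ^ 2) ^ 4)⁻¹ := by
      rw [← div_eq_mul_inv, le_div_iff₀ (by positivity)]; exact hC y
    calc |q y| * ‖m k y‖ ≤ C * ((1 + y ^ 2) ^ 4)⁻¹ * (M * (1 + y ^ 2)) := by
          gcongr; exact hM k y
      _ = _ := by have := (hpos y).ne'; field_simp
  have hgb1 : ∀ k y, ‖(q y : ℂ) * m k y‖ ≤ C * M * (1 + y ^ 2)⁻¹ := fun k y => by
    refine (hgb k y).trans ?_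
    gcongr
    refine mul_le_of_le_one_right (by positivity) (inv_le_one_of_one_le₀ ?_)
    exact one_le_pow₀ (by nlinarith [sq_nonneg y])
  have hyb : ∀ y : ℝ, |y| ≤ 1 + y ^ 2 := fun y => by
    nlinarith [sq_abs y, sq_nonneg (|y| - 1), abs_nonneg y]
  have hgi : ∀ k, Integrable fun y => (q y : ℂ) * m k y := fun k =>
    Integrable.mono' (integrable_inv_one_add_sq.const_mul _) (hgc k).aestronglyMeasurable
      (Eventually.of_forall (hgb1 k))
  have hgi1 : ∀ k, Integrable fun y : ℝ => (y : ℂ) * ((q y : ℂ) * m k y) := fun k => by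
    have := hgc k
    refine Integrable.mono' (integrable_inv_one_add_sq.const_mul (C * M))
      (by fun_prop : Continuous _).aestronglyMeasurable (Eventually.of_forall fun y => ?_)
    rw [norm_mul, Complex.norm_real, Real.norm_eq_abs]
    calc |y| * ‖(q y : ℂ) * m k y‖
        ≤ (1 + y ^ 2) * (C * M * ((1 + y ^ 2)⁻¹ * ((1 + y ^ 2) ^ 2)⁻¹)) := by
          gcongr
          exacts [hyb y, hgb k y]
      _ = C * M * (1 + y ^ 2)⁻¹ * (1 + y ^ 2)⁻¹ := by have := (hpos y).ne'; field_simp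
      _ ≤ _ := by
        refine mul_le_of_le_one_right (by positivity) (inv_le_one_of_one_le₀ ?_)
        nlinarith [sq_nonneg y]
  -- One of the two factors `(1 + y²)⁻¹` is bounded by its value at `ξ ≥ 0`; the other is integrated
  -- and gives `π`.
  have htail : ∀ (ξ : ℝ) (F : ℝ → ℂ), 0 ≤ ξ →
      (∀ y, ξ < y → ‖F y‖ ≤ C * M * ((1 + y ^ 2)⁻¹ * (1 + y ^ 2)⁻¹)) →
      ‖∫ y in Set.Ioi ξ, F y‖ ≤ C * M * Real.pi * (1 + ξ ^ 2)⁻¹ := by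
    intro ξ F hξ hF
    refine (norm_integral_le_of_norm_le (g := fun y => C * M * (1 + ξ ^ 2)⁻¹ * (1 + y ^ 2)⁻¹)
      (integrable_inv_one_add_sq.const_mul _).integrableOn
      ((ae_restrict_iff' measurableSet_Ioi).2 (Eventually.of_forall fun y hy => ?_))).trans ?_
    · refine (hF y hy).trans ?_
      rw [← mul_assoc]
      have : ξ < y := hy
      gcongr
    · rw [integral_const_mul]
      have h1 : ∫ y in Set.Ioi ξ, (1 + y ^ 2)⁻¹ ≤ Real.pi := by
        rw [← integral_univ_inv_one_add_sq]
        exact setIntegral_le_integral integrable_inv_one_add_sq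
          (Eventually.of_forall fun y => inv_nonneg.2 (hpos y).le)
      calc C * M * (1 + ξ ^ 2)⁻¹ * ∫ y in Set.Ioi ξ, (1 + y ^ 2)⁻¹
          ≤ C * M * (1 + ξ ^ 2)⁻¹ * Real.pi := by gcongr
        _ = _ := by ring
  refine ⟨{
    m := m
    n := fun k ξ => -∫ y in Set.Ioi ξ,
      Complex.exp (2 * Complex.I * k * (y - ξ : ℝ)) * (q y * m k y)
    M := C * M * Real.pi
    continuous_m := hmc
    continuous_n := fun ξ => ?_
    hasDerivAt_m := fun k ξ => ?_
    hasDerivAt_n := fun k ξ => hasDerivAt_jost_deriv (hgc k) (hgi k) ξ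
    norm_m_sub_one_le := fun k ξ hξ => ?_
    norm_n_le := fun k ξ hξ => ?_ }⟩
  · refine (continuous_of_dominated (bound := fun y => C * M * (1 + y ^ 2)⁻¹) (fun k => ?_)
      (fun k => (ae_restrict_iff' measurableSet_Ioi).2 (Eventually.of_forall fun y hy => ?_))
      (integrable_inv_one_add_sq.const_mul _).integrableOn (Eventually.of_forall fun y => ?_)).neg
    · have := hgc k
      exact (by fun_prop : Continuous _).aestronglyMeasurable
    · rw [norm_mul]
      exact (mul_le_of_le_one_left (norm_nonneg _)
        (norm_exp_two_I_mul_le k (sub_nonneg.2 (le_of_lt hy)))).trans (hgb1 k y)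
    · have : Continuous fun k => m k y :=
        hmc.comp (by fun_prop : Continuous fun k : ClosedUpperHalfPlane => (k, y))
      fun_prop
  · refine (hasDerivAt_jost (k := k) (hgc k) (hgi k) (hgi1 k) ξ).congr_of_eventuallyEq ?_
    exact Eventually.of_forall fun a => hm k a
  · rw [hm k ξ, add_sub_cancel_left]
    refine htail ξ _ hξ fun y hy => ?_
    have h0 : 0 ≤ y - ξ := sub_nonneg.2 hy.le
    rw [norm_mul, norm_mul, Complex.norm_of_nonneg h0]
    have h1 : ‖expSlope (2 * Complex.I * k * (y - ξ : ℝ))‖ ≤ 1 := by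
      refine norm_expSlope_le ?_
      have h : (2 * Complex.I * (k : ℂ) * (y - ξ : ℝ)).re = -(2 * (k : ℂ).im * (y - ξ)) := by
        simp [Complex.mul_re, Complex.mul_im]
      rw [h]
      have := k.2
      simp only [Left.neg_nonpos_iff]
      positivity
    have h2 : y - ξ ≤ 1 + y ^ 2 := by linarith [hyb y, le_abs_self y]
    calc (y - ξ) * ‖expSlope (2 * Complex.I * k * (y - ξ : ℝ))‖ * ‖(q y : ℂ) * m k y‖
        ≤ (1 + y ^ 2) * 1 * (C * M * ((1 + y ^ 2)⁻¹ * ((1 + y ^ 2) ^ 2)⁻¹)) := by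
          gcongr
          exact hgb k y
      _ = _ := by have := (hpos y).ne'; field_simp
  · rw [norm_neg]
    refine htail ξ _ hξ fun y hy => ?_
    rw [norm_mul]
    refine (mul_le_of_le_one_left (norm_nonneg _)
      (norm_exp_two_I_mul_le k (sub_nonneg.2 hy.le))).trans ((hgb k y).trans ?_)
    gcongr
    nlinarith [sq_nonneg y, sq_nonneg (y ^ 2)]

/-! ### Linear second order equations -/

/-- A function with a derivative of size `c / (1 + x²)` which vanishes at `+∞` has size `c π`. -/
theorem norm_le_of_tendsto_zero {E : Type*} [NormedAddCommGroup E] [NormedSpace ℝ E]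
    {f f' : ℝ → E} (hf : ∀ x, HasDerivAt f (f' x) x) (h0 : Tendsto f atTop (𝓝 0)) {a c : ℝ}
    (hb : ∀ x, a ≤ x → ‖f' x‖ ≤ c * (1 + x ^ 2)⁻¹) : ‖f a‖ ≤ c * Real.pi := by
  have hc : 0 ≤ c := by
    have h := (norm_nonneg _).trans (hb a le_rfl)
    have h1 : 0 < (1 + a ^ 2)⁻¹ := by positivity
    exact nonneg_of_mul_nonneg_left h h1
  have key : ∀ b, a ≤ b → ‖f b - f a‖ ≤ c * Real.pi := by
    intro b hab
    have h := image_norm_le_of_norm_deriv_right_le_deriv_boundary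
      (f := fun x => f x - f a) (f' := f') (a := a) (b := b)
      (B := fun x => c * (Real.arctan x - Real.arctan a)) (B' := fun x => c * (1 + x ^ 2)⁻¹)
      (fun x _ => ((hf x).sub_const _).continuousAt.continuousWithinAt)
      (fun x _ => ((hf x).sub_const _).hasDerivWithinAt) (by simp)
      (fun x => (((Real.hasDerivAt_arctan x).sub_const _).const_mul c).congr_deriv (by simp))
      (fun x hx => hb x hx.1) (Set.right_mem_Icc.2 hab)
    refine h.trans ?_
    gcongr
    linarith [Real.arctan_lt_pi_div_two b, Real.neg_pi_div_two_lt_arctan a]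
  have hl : Tendsto (fun b => ‖f b - f a‖) atTop (𝓝 ‖0 - f a‖) := (h0.sub_const _).norm
  rw [zero_sub, norm_neg] at hl
  refine le_of_tendsto hl ?_
  filter_upwards [eventually_ge_atTop a] with b hab using key b hab

theorem eq_zero_of_cauchy_data {E : Type*} [NormedAddCommGroup E] [NormedSpace ℝ E]
    {Q : ℝ → ℝ} (hQ : Continuous Q) {y y' : ℝ → E} (h : ∀ t, HasDerivAt y (y' t) t)
    (h' : ∀ t, HasDerivAt y' (Q t • y t) t) {a : ℝ} (ha : y a = 0) (ha' : y' a = 0) (t : ℝ) :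
    y t = 0 := by
  set R := |t| + |a| + 1 with hR
  obtain ⟨B, hB⟩ := (isCompact_Icc (a := -R) (b := R)).exists_bound_of_continuousOn
    hQ.continuousOn
  have ht : t ∈ Set.Ioo (-R) R := by
    constructor <;> cases abs_cases t <;> linarith [abs_nonneg a]
  have hta : a ∈ Set.Ioo (-R) R := by
    constructor <;> cases abs_cases a <;> linarith [abs_nonneg t]
  have huniq := ODE_solution_unique_of_mem_Ioo (E := E × E) (v := fun t p => (p.2, Q t • p.1))
    (s := fun _ => Set.univ) (K := ⟨max 1 B, by positivity⟩) (a := -R) (b := R) (t₀ := a)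
    (f := fun t => (y t, y' t)) (g := fun _ => 0)
    (fun s hs => by
      refine LipschitzWith.lipschitzOnWith (LipschitzWith.of_dist_le_mul fun p r => ?_)
      rw [dist_eq_norm, dist_eq_norm, Prod.norm_def]
      refine max_le ?_ ?_
      · show ‖p.2 - r.2‖ ≤ max 1 B * ‖p - r‖
        calc ‖p.2 - r.2‖ ≤ 1 * ‖p - r‖ := by rw [one_mul]; exact norm_snd_le (p - r)
          _ ≤ _ := by gcongr; exact le_max_left _ _
      · show ‖Q s • p.1 - Q s • r.1‖ ≤ max 1 B * ‖p - r‖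
        rw [← smul_sub, norm_smul]
        gcongr
        · exact (hB s (Set.Ioo_subset_Icc_self hs)).trans (le_max_right _ _)
        · exact norm_fst_le (p - r))
    hta (fun s _ => ⟨(h s).prodMk (h' s), trivial⟩)
    (fun s _ => ⟨(hasDerivAt_const s (0 : E × E)).congr_deriv (by ext <;> simp), trivial⟩)
    (by simp [ha, ha']) ht
  exact congrArg Prod.fst huniq

/-- With `z b ≠ 0` and vanishing Wronskian, `y - (y b / z b) z` has zero Cauchy data at `b`. -/
theorem exists_eq_const_mul {Q : ℝ → ℝ} (hQ : Continuous Q) {y y' z z' : ℝ → ℂ}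
    (hy : ∀ t, HasDerivAt y (y' t) t) (hy' : ∀ t, HasDerivAt y' (Q t * y t) t)
    (hz : ∀ t, HasDerivAt z (z' t) t) (hz' : ∀ t, HasDerivAt z' (Q t * z t) t)
    {a b : ℝ} (hW : y a * z' a - y' a * z a = 0) (hb : z b ≠ 0) :
    ∃ c : ℂ, ∀ t, y t = c * z t := by
  have hWb : y b * z' b - y' b * z b = 0 := by
    rw [← hW]
    exact wronskian_eq (Q := fun t => (Q t : ℂ)) hy hy' hz hz' b a
  refine ⟨y b / z b, fun t => ?_⟩
  refine sub_eq_zero.1 (eq_zero_of_cauchy_data hQ (y := fun t => y t - y b / z b * z t)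
    (y' := fun t => y' t - y b / z b * z' t) (a := b)
    (fun t => (hy t).sub ((hz t).const_mul _)) (fun t => ?_) ?_ ?_ t)
  · refine ((hy' t).sub ((hz' t).const_mul _)).congr_deriv ?_
    rw [Complex.real_smul]; ring
  · field_simp; ring
  · field_simp; linear_combination -hWb

/-- The limit is a variable `c`, with `c = 0` discharged by `simp` by default, so that limits such
as `0 * w` can be supplied unsimplified. -/
theorem tendsto_mul_of_norm_eq_one {u F : ℝ → ℂ} (hu : ∀ ξ, ‖u ξ‖ = 1) {l : Filter ℝ} {c : ℂ}
    (hF : Tendsto F l (𝓝 c)) (hc : c = 0 := by simp) :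
    Tendsto (fun ξ => u ξ * F ξ) l (𝓝 0) := by
  subst hc
  rw [tendsto_zero_iff_norm_tendsto_zero] at hF ⊢
  refine hF.congr fun ξ => ?_
  rw [norm_mul, hu, one_mul]

/-! ### The wave functions of a Jost solution -/

theorem tendsto_inv_one_add_sq : Tendsto (fun x : ℝ => (1 + x ^ 2)⁻¹) atTop (𝓝 0) :=
  tendsto_inv_atTop_zero.comp
    (tendsto_atTop_add_const_left _ _ (tendsto_pow_atTop two_ne_zero))

/-- A real wave number, as a point of the closed upper half plane. -/
def realPoint (k : ℝ) : ClosedUpperHalfPlane := ⟨k, by simp⟩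

@[simp] theorem coe_realPoint (k : ℝ) : (realPoint k : ℂ) = k := rfl

theorem continuous_realPoint : Continuous realPoint :=
  Complex.continuous_ofReal.subtype_mk _

namespace JostSolution

variable {q : ℝ → ℝ} (J : JostSolution q)

/-- The solution `ψ = e^{ikξ} m(k, ξ)` of `ψ'' = (q - k²) ψ`. -/
noncomputable def wave (k : ClosedUpperHalfPlane) (ξ : ℝ) : ℂ :=
  Complex.exp (Complex.I * k * ξ) * J.m k ξ

/-- The derivative of `wave`. -/
noncomputable def waveDeriv (k : ClosedUpperHalfPlane) (ξ : ℝ) : ℂ :=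
  Complex.exp (Complex.I * k * ξ) * (J.n k ξ + Complex.I * k * J.m k ξ)

theorem hasDerivAt_exp (k : ℂ) (ξ : ℝ) :
    HasDerivAt (fun ξ : ℝ => Complex.exp (Complex.I * k * ξ))
      (Complex.exp (Complex.I * k * ξ) * (Complex.I * k)) ξ :=
  (((hasDerivAt_id ξ).ofReal_comp.const_mul (Complex.I * k)).cexp).congr_deriv (by simp)

theorem hasDerivAt_wave (k : ClosedUpperHalfPlane) (ξ : ℝ) :
    HasDerivAt (J.wave k) (J.waveDeriv k ξ) ξ :=
  ((hasDerivAt_exp k ξ).mul (J.hasDerivAt_m k ξ)).congr_deriv (by rw [waveDeriv]; ring)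

theorem hasDerivAt_waveDeriv (k : ClosedUpperHalfPlane) (ξ : ℝ) :
    HasDerivAt (J.waveDeriv k) (((q ξ : ℂ) - k ^ 2) * J.wave k ξ) ξ := by
  refine ((hasDerivAt_exp k ξ).mul ((J.hasDerivAt_n k ξ).add
    ((J.hasDerivAt_m k ξ).const_mul (Complex.I * k)))).congr_deriv ?_
  rw [wave]
  simp only [Pi.add_apply]
  linear_combination (Complex.exp (Complex.I * k * ξ) * (k : ℂ) ^ 2 * J.m k ξ) * Complex.I_sq

theorem tendsto_m (k : ClosedUpperHalfPlane) : Tendsto (J.m k) atTop (𝓝 1) := by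
  rw [tendsto_iff_norm_sub_tendsto_zero]
  have h := tendsto_inv_one_add_sq.const_mul J.M
  rw [mul_zero] at h
  refine squeeze_zero' (Eventually.of_forall fun _ => norm_nonneg _) ?_ h
  filter_upwards [eventually_ge_atTop 0] with ξ hξ using J.norm_m_sub_one_le k ξ hξ

theorem tendsto_n (k : ClosedUpperHalfPlane) : Tendsto (J.n k) atTop (𝓝 0) := by
  have h := tendsto_inv_one_add_sq.const_mul J.M
  rw [mul_zero] at h
  refine squeeze_zero_norm' ?_ h
  filter_upwards [eventually_ge_atTop 0] with ξ hξ using J.norm_n_le k ξ hξ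

theorem isRightWave (hq : Continuous q) (k : ℝ) : IsRightWave q k (J.wave (realPoint k)) := by
  refine ⟨IsWave.of_hasDerivAt hq (J.hasDerivAt_wave _) (J.hasDerivAt_waveDeriv _), ?_⟩
  refine (J.tendsto_m (realPoint k)).congr fun ξ => ?_
  rw [wave, ← mul_assoc, ← Complex.exp_add, coe_realPoint]
  simp

theorem norm_exp_real (k ξ : ℝ) : ‖Complex.exp (Complex.I * k * ξ)‖ = 1 := by
  rw [show Complex.I * k * ξ = ((k * ξ : ℝ) : ℂ) * Complex.I by push_cast; ring,
    Complex.norm_exp_ofReal_mul_I]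

/-- The constant is read off at `+∞`, where `m → 1`, `n → 0` and the two exponentials cancel. -/
theorem wronskian_neg (k : ℝ) (ξ : ℝ) :
    J.wave (realPoint (-k)) ξ * J.waveDeriv (realPoint k) ξ -
      J.waveDeriv (realPoint (-k)) ξ * J.wave (realPoint k) ξ = 2 * Complex.I * k := by
  have hW := fun η => wronskian_eq (Q := fun ξ => (q ξ : ℂ) - k ^ 2)
    (J.hasDerivAt_wave (realPoint (-k)))
    (fun ξ => (J.hasDerivAt_waveDeriv (realPoint (-k)) ξ).congr_deriv (by simp))
    (J.hasDerivAt_wave (realPoint k)) (J.hasDerivAt_waveDeriv (realPoint k)) η ξ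
  refine tendsto_nhds_unique (tendsto_const_nhds (f := atTop (α := ℝ))) (?_ : Tendsto _ _ _)
  have h : Tendsto (fun η => J.m (realPoint (-k)) η *
      (J.n (realPoint k) η + Complex.I * k * J.m (realPoint k) η) -
      (J.n (realPoint (-k)) η + Complex.I * (-k) * J.m (realPoint (-k)) η) *
        J.m (realPoint k) η) atTop
      (𝓝 (1 * (0 + Complex.I * k * 1) - (0 + Complex.I * (-k) * 1) * 1)) :=
    ((J.tendsto_m _).mul ((J.tendsto_n _).add ((J.tendsto_m _).const_mul _))).sub
      (((J.tendsto_n _).add ((J.tendsto_m _).const_mul _)).mul (J.tendsto_m _))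
  rw [show (1 * (0 + Complex.I * k * 1) - (0 + Complex.I * (-k) * 1) * 1 : ℂ) =
    2 * Complex.I * k by ring] at h
  refine h.congr fun η => ?_
  rw [← hW η]
  have he : Complex.exp (Complex.I * (-k : ℝ) * η) * Complex.exp (Complex.I * k * η) = 1 := by
    rw [← Complex.exp_add]; simp
  simp only [wave, waveDeriv, coe_realPoint]
  push_cast at he ⊢
  linear_combination (-(J.m (realPoint (-k)) η *
      (J.n (realPoint k) η + Complex.I * k * J.m (realPoint k) η) -
      (J.n (realPoint (-k)) η + Complex.I * (-k) * J.m (realPoint (-k)) η) *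
        J.m (realPoint k) η)) * he

theorem eq_wave_of_isRightWave {k : ℝ} (hk : k ≠ 0) {χ : ℝ → ℂ} (hχ : IsRightWave q k χ) :
    χ = J.wave (realPoint k) := by
  obtain ⟨d1, d2⟩ := hχ.1.hasDerivAt
  set p := J.wave (realPoint k) with hp
  set p' := J.waveDeriv (realPoint k) with hp'
  set r := J.wave (realPoint (-k)) with hr
  set r' := J.waveDeriv (realPoint (-k)) with hr'
  set y : ℝ → ℂ := fun ξ => χ ξ - p ξ with hy
  set y' : ℝ → ℂ := fun ξ => deriv χ ξ - p' ξ with hy'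
  have hp1 : ∀ ξ, HasDerivAt p (p' ξ) ξ := J.hasDerivAt_wave _
  have hp2 : ∀ ξ, HasDerivAt p' (((q ξ : ℂ) - k ^ 2) * p ξ) ξ := J.hasDerivAt_waveDeriv _
  have hr1 : ∀ ξ, HasDerivAt r (r' ξ) ξ := J.hasDerivAt_wave _
  have hr2 : ∀ ξ, HasDerivAt r' (((q ξ : ℂ) - k ^ 2) * r ξ) ξ := fun ξ =>
    (J.hasDerivAt_waveDeriv _ ξ).congr_deriv (by simp [hr])
  have hy1 : ∀ ξ, HasDerivAt y (y' ξ) ξ := fun ξ => (d1 ξ).sub (hp1 ξ)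
  have hy2 : ∀ ξ, HasDerivAt y' (((q ξ : ℂ) - k ^ 2) * y ξ) ξ := fun ξ =>
    ((d2 ξ).sub (hp2 ξ)).congr_deriv (by rw [hy]; ring)
  set A := y 0 * p' 0 - y' 0 * p 0 with hA
  set B := r 0 * y' 0 - r' 0 * y 0 with hB
  -- Three-term identity `y W(r,p) = r W(y,p) + p W(r,y)`, with all Wronskians constant.
  -- Asymptotically the right side is `A e^{-ikξ} + B e^{ikξ}`, which must tend to zero.
  have hrep : ∀ ξ, y ξ * (2 * Complex.I * k) = r ξ * A + p ξ * B := by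
    intro ξ
    rw [← J.wronskian_neg k ξ, hA, hB,
      ← wronskian_eq (Q := fun ξ => (q ξ : ℂ) - k ^ 2) hy1 hy2 hp1 hp2 ξ 0,
      ← wronskian_eq (Q := fun ξ => (q ξ : ℂ) - k ^ 2) hr1 hr2 hy1 hy2 ξ 0]
    ring
  have hlim : Tendsto (fun ξ : ℝ => A + B * Complex.exp (2 * Complex.I * k * ξ)) atTop (𝓝 0) := by
    have h1 : Tendsto (fun ξ : ℝ => Complex.exp (-(Complex.I * k * ξ)) * y ξ) atTop (𝓝 0) := by
      have h := hχ.2.sub (J.tendsto_m (realPoint k))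
      rw [sub_self] at h
      refine h.congr fun ξ => ?_
      have he : Complex.exp (-(Complex.I * k * ξ)) * Complex.exp (Complex.I * k * ξ) = 1 := by
        rw [← Complex.exp_add]; simp
      simp only [hy, hp, wave, coe_realPoint]
      linear_combination J.m (realPoint k) ξ * he
    have h2 := tendsto_mul_of_norm_eq_one (u := fun ξ : ℝ => Complex.exp (Complex.I * k * ξ) ^ 2)
      (fun ξ => by rw [norm_pow, norm_exp_real, one_pow]) (h1.mul_const (2 * Complex.I * (k : ℂ)))
    have h3 := ((J.tendsto_m (realPoint (-k))).sub_const 1).mul_const A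
    have h4 := tendsto_mul_of_norm_eq_one (u := fun ξ : ℝ => Complex.exp (Complex.I * k * ξ) ^ 2)
      (fun ξ => by rw [norm_pow, norm_exp_real, one_pow])
      (F := fun ξ => (J.m (realPoint k) ξ - 1) * B)
      (by simpa using ((J.tendsto_m (realPoint k)).sub_const 1).mul_const B)
    have h5 := (h2.sub h3).sub h4
    simp only [sub_self, zero_mul] at h5
    refine h5.congr fun ξ => ?_
    have e1 : Complex.exp (Complex.I * k * ξ) * Complex.exp (-(Complex.I * k * ξ)) = 1 := by
      rw [← Complex.exp_add]; simp
    have e2 : Complex.exp (Complex.I * k * ξ) * Complex.exp (Complex.I * (-k : ℝ) * ξ) = 1 := by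
      rw [← Complex.exp_add]; simp
    have e3 : Complex.exp (2 * Complex.I * k * ξ) = Complex.exp (Complex.I * k * ξ) ^ 2 := by
      rw [← Complex.exp_nat_mul]; congr 1; push_cast; ring
    have h6 := hrep ξ
    simp only [hr, hp, wave, coe_realPoint] at h6
    rw [e3]
    linear_combination (Complex.exp (Complex.I * k * ξ) * (y ξ * (2 * Complex.I * k))) * e1 +
      Complex.exp (Complex.I * k * ξ) * h6 + J.m (realPoint (-k)) ξ * A * e2
  -- A shift by half a period, `π/(2|k|)`, changes the sign of the oscillating term and separates
  -- `A` from `B`.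
  have hlim' : Tendsto (fun ξ : ℝ => A - B * Complex.exp (2 * Complex.I * k * ξ)) atTop (𝓝 0) := by
    have hs : Tendsto (fun ξ : ℝ => ξ + Real.pi / (2 * |k|)) atTop atTop :=
      tendsto_atTop_add_const_right _ _ tendsto_id
    refine (hlim.comp hs).congr fun ξ => ?_
    have : Complex.exp (2 * Complex.I * k * (ξ + Real.pi / (2 * |k|) : ℝ)) =
        -Complex.exp (2 * Complex.I * k * ξ) := by
      have hk' : (k : ℂ) ≠ 0 := Complex.ofReal_ne_zero.2 hk
      rcases abs_choice k with h | h <;> rw [h]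
      · rw [show 2 * Complex.I * k * ((ξ + Real.pi / (2 * k) : ℝ) : ℂ) =
          2 * Complex.I * k * ξ + Real.pi * Complex.I by push_cast; field_simp,
          Complex.exp_add, Complex.exp_pi_mul_I]
        ring
      · rw [show 2 * Complex.I * k * ((ξ + Real.pi / (2 * -k) : ℝ) : ℂ) =
          2 * Complex.I * k * ξ - Real.pi * Complex.I by push_cast; field_simp; ring,
          Complex.exp_sub, Complex.exp_pi_mul_I]
        ring
    simp only [Function.comp, this]
    ring
  have hA0 : A = 0 := by
    have h := (hlim.add hlim').congr (f₂ := fun _ => 2 * A) fun ξ => by ring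
    have := tendsto_nhds_unique tendsto_const_nhds h
    simpa using this
  have hB0 : B = 0 := by
    have h := (hlim.sub hlim').norm.congr (f₂ := fun _ => 2 * ‖B‖) fun ξ => by
      rw [show A + B * Complex.exp (2 * Complex.I * k * ξ) -
        (A - B * Complex.exp (2 * Complex.I * k * ξ)) =
        2 * B * Complex.exp (Complex.I * (2 * k : ℝ) * ξ) by push_cast; ring_nf,
        norm_mul, norm_exp_real, norm_mul, Complex.norm_two, mul_one]
    have := tendsto_nhds_unique tendsto_const_nhds h
    simpa using this
  funext ξ
  have h := hrep ξ
  rw [hA0, hB0, mul_zero, mul_zero, add_zero] at h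
  have h2 : (2 * Complex.I * k : ℂ) ≠ 0 := by simp [hk]
  exact sub_eq_zero.1 ((mul_eq_zero.1 h).resolve_right h2)

/-- The Wronskian of the wave functions with wave numbers `0` and `k`. -/
theorem norm_wronskian_zero_sub_le : ∃ C, ∀ k : ℝ,
    ‖J.wave (realPoint 0) 0 * J.waveDeriv (realPoint k) 0 -
      J.waveDeriv (realPoint 0) 0 * J.wave (realPoint k) 0 - Complex.I * k‖ ≤ C * k ^ 2 := by
  have hM0 : 0 ≤ J.M := by
    have := (norm_nonneg _).trans (J.norm_n_le (realPoint 0) 0 le_rfl)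
    simpa using this
  refine ⟨(J.M * (1 + J.M) + J.M) * Real.pi, fun k => ?_⟩
  set e : ℝ → ℂ := fun ξ => Complex.exp (Complex.I * k * ξ) with he
  have he1 : ∀ ξ, ‖e ξ‖ = 1 := fun ξ => norm_exp_real k ξ
  have hw0 : J.wave (realPoint 0) = J.m (realPoint 0) := by
    funext ξ; simp [wave]
  have hw0' : J.waveDeriv (realPoint 0) = J.n (realPoint 0) := by
    funext ξ; simp [waveDeriv]
  -- The Wronskian has derivative `-k² e^{ikξ} m₀ m_k`. Subtracting `ik e^{ikξ}` replaces `m₀ m_k`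
  -- by `m₀ m_k - 1`, which is integrable on `[0, ∞)` uniformly in `k`; hence the total is `O(k²)`.
  have hd : ∀ ξ, HasDerivAt (fun ξ => J.wave (realPoint 0) ξ * J.waveDeriv (realPoint k) ξ -
      J.waveDeriv (realPoint 0) ξ * J.wave (realPoint k) ξ - Complex.I * k * e ξ)
      (-(k ^ 2 * (e ξ * ((J.m (realPoint 0) ξ - 1) * J.m (realPoint k) ξ +
        (J.m (realPoint k) ξ - 1))))) ξ := by
    intro ξ
    refine ((((J.hasDerivAt_wave (realPoint 0) ξ).mul (J.hasDerivAt_waveDeriv (realPoint k) ξ)).sub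
      ((J.hasDerivAt_waveDeriv (realPoint 0) ξ).mul (J.hasDerivAt_wave (realPoint k) ξ))).sub
      ((hasDerivAt_exp k ξ).const_mul (Complex.I * k))).congr_deriv ?_
    rw [hw0, hw0']
    simp only [wave, waveDeriv, coe_realPoint, he]
    push_cast
    linear_combination -(k : ℂ) ^ 2 * Complex.exp (Complex.I * k * ξ) * Complex.I_sq
  have h0 : Tendsto (fun ξ => J.wave (realPoint 0) ξ * J.waveDeriv (realPoint k) ξ -
      J.waveDeriv (realPoint 0) ξ * J.wave (realPoint k) ξ - Complex.I * k * e ξ) atTop (𝓝 0) := by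
    have h1 := (((J.tendsto_m (realPoint 0)).mul ((J.tendsto_n (realPoint k)).add
      ((J.tendsto_m (realPoint k)).const_mul (Complex.I * k)))).sub
      ((J.tendsto_n (realPoint 0)).mul (J.tendsto_m (realPoint k)))).sub_const (Complex.I * k)
    rw [show (1 * (0 + Complex.I * k * 1) - 0 * 1 - Complex.I * k : ℂ) = 0 by ring] at h1
    refine (tendsto_mul_of_norm_eq_one he1 h1).congr fun ξ => ?_
    rw [hw0, hw0']
    simp only [wave, waveDeriv, coe_realPoint, he]
    ring
  have key := norm_le_of_tendsto_zero (a := 0) (c := (J.M * (1 + J.M) + J.M) * k ^ 2) hd h0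
    (fun ξ hξ => by
      have b0 := J.norm_m_sub_one_le (realPoint 0) ξ hξ
      have bk := J.norm_m_sub_one_le (realPoint k) ξ hξ
      have hinv : (1 + ξ ^ 2)⁻¹ ≤ 1 := inv_le_one_of_one_le₀ (by nlinarith [sq_nonneg ξ])
      have bm : ‖J.m (realPoint k) ξ‖ ≤ 1 + J.M := by
        have h := norm_add_le (J.m (realPoint k) ξ - 1) 1
        rw [sub_add_cancel, norm_one] at h
        nlinarith
      rw [norm_neg, norm_mul, norm_mul, he1, one_mul, norm_pow, Complex.norm_real,
        Real.norm_eq_abs, sq_abs]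
      calc k ^ 2 * ‖(J.m (realPoint 0) ξ - 1) * J.m (realPoint k) ξ + (J.m (realPoint k) ξ - 1)‖
          ≤ k ^ 2 * (J.M * (1 + ξ ^ 2)⁻¹ * (1 + J.M) + J.M * (1 + ξ ^ 2)⁻¹) := by
            gcongr
            refine (norm_add_le _ _).trans (add_le_add ?_ bk)
            rw [norm_mul]
            gcongr
        _ = _ := by ring)
  have e0 : e 0 = 1 := by simp [he]
  rw [e0, mul_one] at key
  refine key.trans_eq (by ring)

/-- The Wronskian is `ik + O(k²)`. This supplies the first-order information at `k = 0` without
differentiating the Jost solution in `k`. -/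
theorem tendsto_wronskian_zero_div :
    Tendsto (fun k : ℝ => (J.wave (realPoint 0) 0 * J.waveDeriv (realPoint k) 0 -
      J.waveDeriv (realPoint 0) 0 * J.wave (realPoint k) 0) / (2 * Complex.I * k))
      (𝓝[≠] 0) (𝓝 (1 / 2)) := by
  obtain ⟨C, hC⟩ := J.norm_wronskian_zero_sub_le
  rw [tendsto_iff_norm_sub_tendsto_zero]
  have h1 : Tendsto (fun k : ℝ => C / 2 * |k|) (𝓝[≠] 0) (𝓝 0) := by
    have : Tendsto (fun k : ℝ => C / 2 * |k|) (𝓝 0) (𝓝 (C / 2 * |0|)) :=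
      (by fun_prop : Continuous fun k : ℝ => C / 2 * |k|).tendsto 0
    rw [abs_zero, mul_zero] at this
    exact this.mono_left nhdsWithin_le_nhds
  refine squeeze_zero' (Eventually.of_forall fun _ => norm_nonneg _) ?_ h1
  filter_upwards [self_mem_nhdsWithin] with k hk
  have hk0 : (k : ℂ) ≠ 0 := Complex.ofReal_ne_zero.2 hk
  rw [show ∀ w : ℂ, w / (2 * Complex.I * k) - 1 / 2 = (w - Complex.I * k) / (2 * Complex.I * k) from
    fun w => by field_simp [Complex.I_ne_zero], norm_div, norm_mul, norm_mul, Complex.norm_I,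
    Complex.norm_real, Real.norm_eq_abs, Complex.norm_two, mul_one]
  have hk1 : 0 < |k| := abs_pos.2 hk
  rw [div_le_iff₀ (by positivity)]
  refine (hC k).trans_eq ?_
  rw [← sq_abs k]; ring

theorem tendsto_wave (ξ : ℝ) :
    Tendsto (fun k : ℝ => J.wave (realPoint k) ξ) (𝓝[≠] 0) (𝓝 (J.wave (realPoint 0) ξ)) := by
  have h : Continuous fun k : ℝ => J.wave (realPoint k) ξ := by
    have h1 : Continuous fun k : ℝ => J.m (realPoint k) ξ :=
      J.continuous_m.comp (continuous_realPoint.prodMk continuous_const)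
    simp only [wave, coe_realPoint]
    fun_prop
  exact (h.tendsto 0).mono_left nhdsWithin_le_nhds

theorem tendsto_waveDeriv (ξ : ℝ) : Tendsto (fun k : ℝ => J.waveDeriv (realPoint k) ξ) (𝓝[≠] 0)
    (𝓝 (J.waveDeriv (realPoint 0) ξ)) := by
  have h : Continuous fun k : ℝ => J.waveDeriv (realPoint k) ξ := by
    have h1 : Continuous fun k : ℝ => J.m (realPoint k) ξ :=
      J.continuous_m.comp (continuous_realPoint.prodMk continuous_const)
    have h2 : Continuous fun k : ℝ => J.n (realPoint k) ξ :=
      (J.continuous_n ξ).comp continuous_realPoint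
    simp only [waveDeriv, coe_realPoint]
    fun_prop
  exact (h.tendsto 0).mono_left nhdsWithin_le_nhds

end JostSolution

/-! ### Scattering data -/

theorem IsWave.comp_neg {q : ℝ → ℝ} (hq : Continuous q) {k : ℂ} {φ : ℝ → ℂ} (h : IsWave q k φ) :
    IsWave (fun ξ => q (-ξ)) k fun ξ => φ (-ξ) := by
  obtain ⟨d1, d2⟩ := h.hasDerivAt
  refine IsWave.of_hasDerivAt (by fun_prop) (ψ' := fun ξ => -deriv φ (-ξ)) (fun ξ => ?_)
    (fun ξ => ?_)
  · exact ((d1 (-ξ)).scomp ξ (hasDerivAt_neg ξ)).congr_deriv (by simp)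
  · exact ((d2 (-ξ)).scomp ξ (hasDerivAt_neg ξ)).neg.congr_deriv (by simp)

theorem IsLeftWave.comp_neg {q : ℝ → ℝ} (hq : Continuous q) {k : ℝ} {φ : ℝ → ℂ}
    (h : IsLeftWave q k φ) : IsRightWave (fun ξ => q (-ξ)) k fun ξ => φ (-ξ) := by
  refine ⟨h.1.comp_neg hq, (h.2.comp tendsto_neg_atTop_atBot).congr fun ξ => ?_⟩
  simp

theorem IsRightWave.comp_neg {q : ℝ → ℝ} (hq : Continuous q) {k : ℝ} {φ : ℝ → ℂ}
    (h : IsRightWave q k φ) : IsLeftWave (fun ξ => q (-ξ)) k fun ξ => φ (-ξ) := by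
  refine ⟨h.1.comp_neg hq, (h.2.comp tendsto_neg_atBot_atTop).congr fun ξ => ?_⟩
  simp

section Scattering

variable {q : ℝ → ℝ} (J : JostSolution q) (L : JostSolution fun ξ => q (-ξ))

/-- The Wronskian at the origin of the left and right wave functions. -/
noncomputable def jostWronskian (k : ℝ) : ℂ :=
  L.wave (realPoint k) 0 * J.waveDeriv (realPoint k) 0 +
    L.waveDeriv (realPoint k) 0 * J.wave (realPoint k) 0

theorem hasDerivAt_wave_neg (k : ClosedUpperHalfPlane) (ξ : ℝ) :
    HasDerivAt (fun ξ => L.wave k (-ξ)) (-L.waveDeriv k (-ξ)) ξ :=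
  ((L.hasDerivAt_wave k (-ξ)).scomp ξ (hasDerivAt_neg ξ)).congr_deriv (by simp)

theorem hasDerivAt_waveDeriv_neg (k : ClosedUpperHalfPlane) (ξ : ℝ) :
    HasDerivAt (fun ξ => -L.waveDeriv k (-ξ)) (((q ξ : ℂ) - k ^ 2) * L.wave k (-ξ)) ξ :=
  ((L.hasDerivAt_waveDeriv k (-ξ)).scomp ξ (hasDerivAt_neg ξ)).neg.congr_deriv (by simp)

theorem isLeftWave_wave_neg (hq : Continuous q) (k : ℝ) :
    IsLeftWave q k fun ξ => L.wave (realPoint k) (-ξ) := by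
  have h := (L.isRightWave (by fun_prop) k).comp_neg (by fun_prop)
  simpa using h

theorem isScatteringData_jost (hq : Continuous q) :
    IsScatteringData q (fun k => jostWronskian J L k / (2 * Complex.I * k))
      (fun k => (J.wave (realPoint (-k)) 0 * -L.waveDeriv (realPoint k) 0 -
        J.waveDeriv (realPoint (-k)) 0 * L.wave (realPoint k) 0) / (2 * Complex.I * k)) := by
  intro k hk
  refine ⟨_, _, _, isLeftWave_wave_neg L hq k, J.isRightWave hq k, J.isRightWave hq (-k),
    fun ξ => ?_⟩
  have h1 := wronskian_eq (Q := fun ξ => (q ξ : ℂ) - k ^ 2)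
    (hasDerivAt_wave_neg L (realPoint k)) (hasDerivAt_waveDeriv_neg L (realPoint k))
    (J.hasDerivAt_wave (realPoint k)) (J.hasDerivAt_waveDeriv (realPoint k)) ξ 0
  have h2 := wronskian_eq (Q := fun ξ => (q ξ : ℂ) - k ^ 2)
    (J.hasDerivAt_wave (realPoint (-k)))
    (fun ξ => (J.hasDerivAt_waveDeriv (realPoint (-k)) ξ).congr_deriv (by simp))
    (hasDerivAt_wave_neg L (realPoint k)) (hasDerivAt_waveDeriv_neg L (realPoint k)) ξ 0
  have h3 := J.wronskian_neg k ξ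
  have hk' : (k : ℂ) ≠ 0 := Complex.ofReal_ne_zero.2 hk
  have hI := Complex.I_ne_zero
  simp only [neg_zero] at h1 h2
  simp only [jostWronskian]
  rw [div_mul_eq_mul_div, div_mul_eq_mul_div, ← add_div, eq_div_iff (by simp [hk]), ← h3]
  linear_combination J.wave (realPoint (-k)) ξ * h1 + J.wave (realPoint k) ξ * h2

/-- Uniqueness of the normalized waves for `k ≠ 0` identifies any given scattering data with the
Jost ones; pairing `φ` with `ψ₊` then eliminates `b`. -/
theorem IsScatteringData.mul_eq_jostWronskian (hq : Continuous q) {a b : ℝ → ℂ}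
    (h : IsScatteringData q a b) {k : ℝ} (hk : k ≠ 0) :
    a k * (2 * Complex.I * k) = jostWronskian J L k := by
  obtain ⟨φ, ψp, ψm, hφ, hp, hm, heq⟩ := h k hk
  obtain rfl := J.eq_wave_of_isRightWave hk hp
  obtain rfl := J.eq_wave_of_isRightWave (neg_ne_zero.2 hk) hm
  have hφ' := L.eq_wave_of_isRightWave hk (hφ.comp_neg hq)
  have e1 : ∀ ξ, L.wave (realPoint k) (-ξ) =
      a k * J.wave (realPoint (-k)) ξ + b k * J.wave (realPoint k) ξ := fun ξ => by
    rw [← heq, ← hφ']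
    simp only [neg_neg]
  have e2 : -L.waveDeriv (realPoint k) (-0) =
      a k * J.waveDeriv (realPoint (-k)) 0 + b k * J.waveDeriv (realPoint k) 0 := by
    refine (hasDerivAt_wave_neg L (realPoint k) 0).unique ?_
    rw [funext e1]
    exact ((J.hasDerivAt_wave (realPoint (-k)) 0).const_mul _).add
      ((J.hasDerivAt_wave (realPoint k) 0).const_mul _)
  have e3 := e1 0
  rw [neg_zero] at e2 e3
  rw [jostWronskian, ← J.wronskian_neg k 0]
  linear_combination J.wave (realPoint k) 0 * e2 - J.waveDeriv (realPoint k) 0 * e3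

/-- Let `ψ_k` and `ℓ_k` be the waves of `J` and `L`. At the origin, proportionality at zero energy
gives `ψ₀ · jostWronskian = ℓ_k W(ψ₀, ψ_k) + c⁻¹ ψ_k W(ℓ₀, ℓ_k)`. Each `W/(2ik)` tends to `1/2`, and
`ℓ₀ = c ψ₀`. -/
theorem tendsto_jostWronskian_div {c : ℂ} (hc : c ≠ 0)
    (h : ∀ ξ, L.wave (realPoint 0) (-ξ) = c * J.wave (realPoint 0) ξ)
    (h0 : J.wave (realPoint 0) 0 ≠ 0) :
    Tendsto (fun k : ℝ => jostWronskian J L k / (2 * Complex.I * k)) (𝓝[≠] 0)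
      (𝓝 ((c + c⁻¹) / 2)) := by
  have e0 : L.wave (realPoint 0) 0 = c * J.wave (realPoint 0) 0 := by simpa using h 0
  have e1 : -L.waveDeriv (realPoint 0) 0 = c * J.waveDeriv (realPoint 0) 0 := by
    have h1 := hasDerivAt_wave_neg L (realPoint 0) 0
    rw [neg_zero, funext h] at h1
    exact h1.unique ((J.hasDerivAt_wave (realPoint 0) 0).const_mul c)
  have hl := (((L.tendsto_wave 0).mul J.tendsto_wronskian_zero_div).add
    (((J.tendsto_wave 0).mul L.tendsto_wronskian_zero_div).mul_const c⁻¹)).div_const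
    (J.wave (realPoint 0) 0)
  have hlim : (L.wave (realPoint 0) 0 * (1 / 2) + J.wave (realPoint 0) 0 * (1 / 2) * c⁻¹) /
      J.wave (realPoint 0) 0 = (c + c⁻¹) / 2 := by
    rw [e0]; field_simp
  rw [hlim] at hl
  refine hl.congr fun k => ?_
  have e1' : L.waveDeriv (realPoint 0) 0 = -(c * J.waveDeriv (realPoint 0) 0) := by
    rw [← e1, neg_neg]
  rw [jostWronskian, e0, e1']
  field_simp
  ring

end Scattering

/-! ### Positivity of the wave function at zero energy -/

/-- The wave number `i |ω|`, as a point of the closed upper half plane. -/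
def imagPoint (ω : ℝ) : ClosedUpperHalfPlane := ⟨Complex.I * (|ω| : ℝ), by simp⟩

@[simp] theorem coe_imagPoint (ω : ℝ) : (imagPoint ω : ℂ) = Complex.I * (|ω| : ℝ) := rfl

theorem continuous_imagPoint : Continuous imagPoint :=
  (by fun_prop : Continuous fun ω : ℝ => Complex.I * (|ω| : ℝ)).subtype_mk _

theorem pos_on_Icc_of_ne_zero {f : ℝ → ℝ} (hf : Continuous f) {a b : ℝ} (hab : a ≤ b)
    (hb : 0 < f b) (h : ∀ x ∈ Set.Icc a b, f x ≠ 0) : 0 < f a := by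
  by_contra! hn
  obtain ⟨x, hx, hx0⟩ := intermediate_value_Icc hab hf.continuousOn ⟨hn, hb.le⟩
  exact h x hx hx0

namespace JostSolution

variable {q : ℝ → ℝ} (J : JostSolution q)

/-- The real part of the decaying solution of `u'' = (q + ω²) u`. -/
noncomputable def realWave (ω ξ : ℝ) : ℝ := Real.exp (-(|ω| * ξ)) * (J.m (imagPoint ω) ξ).re

/-- The derivative of `realWave`. -/
noncomputable def realWaveDeriv (ω ξ : ℝ) : ℝ :=
  Real.exp (-(|ω| * ξ)) * ((J.n (imagPoint ω) ξ).re - |ω| * (J.m (imagPoint ω) ξ).re)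

theorem realWave_eq (ω ξ : ℝ) : J.realWave ω ξ = (J.wave (imagPoint ω) ξ).re := by
  have h : Complex.exp (Complex.I * imagPoint ω * ξ) = (Real.exp (-(|ω| * ξ)) : ℝ) := by
    rw [Complex.ofReal_exp, coe_imagPoint, ← mul_assoc, Complex.I_mul_I]
    push_cast; ring_nf
  rw [realWave, wave, h, Complex.re_ofReal_mul]

theorem realWaveDeriv_eq (ω ξ : ℝ) : J.realWaveDeriv ω ξ = (J.waveDeriv (imagPoint ω) ξ).re := by
  have h : Complex.exp (Complex.I * imagPoint ω * ξ) = (Real.exp (-(|ω| * ξ)) : ℝ) := by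
    rw [Complex.ofReal_exp, coe_imagPoint, ← mul_assoc, Complex.I_mul_I]
    push_cast; ring_nf
  have h2 : Complex.I * (imagPoint ω : ℂ) * J.m (imagPoint ω) ξ =
      ((-|ω| : ℝ) : ℂ) * J.m (imagPoint ω) ξ := by
    rw [coe_imagPoint, ← mul_assoc, Complex.I_mul_I]; push_cast; ring
  rw [realWaveDeriv, waveDeriv, h, h2, Complex.re_ofReal_mul, Complex.add_re,
    Complex.re_ofReal_mul]
  ring

theorem hasDerivAt_realWave (ω ξ : ℝ) : HasDerivAt (J.realWave ω) (J.realWaveDeriv ω ξ) ξ := by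
  rw [funext (J.realWave_eq ω), realWaveDeriv_eq]
  exact Complex.reCLM.hasFDerivAt.comp_hasDerivAt ξ (J.hasDerivAt_wave (imagPoint ω) ξ)

/-- At `k = i|ω|` the number `k² = -ω²` is real, so real parts satisfy the same equation; reality of
`m` itself is not needed. -/
theorem hasDerivAt_realWaveDeriv (ω ξ : ℝ) :
    HasDerivAt (J.realWaveDeriv ω) ((q ξ + ω ^ 2) * J.realWave ω ξ) ξ := by
  rw [funext (J.realWaveDeriv_eq ω), realWave_eq]
  refine (Complex.reCLM.hasFDerivAt.comp_hasDerivAt ξ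
    (J.hasDerivAt_waveDeriv (imagPoint ω) ξ)).congr_deriv ?_
  have h : ((q ξ : ℂ) - (imagPoint ω : ℂ) ^ 2) = ((q ξ + ω ^ 2 : ℝ) : ℂ) := by
    rw [coe_imagPoint, mul_pow, Complex.I_sq, ← Complex.ofReal_pow, sq_abs]
    push_cast; ring
  rw [h, Complex.reCLM_apply, Complex.re_ofReal_mul]

theorem continuous_realWave : Continuous fun z : ℝ × ℝ => J.realWave z.1 z.2 := by
  have h : Continuous fun z : ℝ × ℝ => J.m (imagPoint z.1) z.2 :=
    J.continuous_m.comp ((continuous_imagPoint.comp continuous_fst).prodMk continuous_snd)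
  have h2 : Continuous fun z : ℝ × ℝ => (J.m (imagPoint z.1) z.2).re :=
    Complex.continuous_re.comp h
  simp only [realWave]
  fun_prop

theorem continuous_realWaveDeriv (ξ : ℝ) : Continuous fun ω => J.realWaveDeriv ω ξ := by
  have h1 : Continuous fun ω => (J.m (imagPoint ω) ξ).re :=
    Complex.continuous_re.comp
      (J.continuous_m.comp (continuous_imagPoint.prodMk continuous_const))
  have h2 : Continuous fun ω => (J.n (imagPoint ω) ξ).re :=
    Complex.continuous_re.comp ((J.continuous_n ξ).comp continuous_imagPoint)
  simp only [realWaveDeriv]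
  fun_prop

theorem continuous_realWave_right (ω : ℝ) : Continuous (J.realWave ω) :=
  continuous_iff_continuousAt.2 fun ξ => (J.hasDerivAt_realWave ω ξ).continuousAt

/-- The estimate of `m - 1` is uniform in `k`, so one `R` serves all `ω`. -/
theorem exists_realWave_pos : ∃ R, 0 ≤ R ∧ ∀ ω ξ, R ≤ ξ → 0 < J.realWave ω ξ := by
  have h := tendsto_inv_one_add_sq.const_mul J.M
  rw [mul_zero] at h
  obtain ⟨R, hR⟩ := eventually_atTop.1 (h.eventually_lt_const one_pos)
  refine ⟨max R 0, le_max_right _ _, fun ω ξ hξ => ?_⟩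
  have h1 := J.norm_m_sub_one_le (imagPoint ω) ξ ((le_max_right _ _).trans hξ)
  have h2 := hR ξ ((le_max_left _ _).trans hξ)
  have h3 := (Complex.abs_re_le_norm (J.m (imagPoint ω) ξ - 1)).trans h1
  rw [Complex.sub_re, Complex.one_re] at h3
  exact mul_pos (Real.exp_pos _) (by linarith [(abs_le.1 h3).1])

/-- A zero would be a minimum, hence a double zero, and the solution would vanish identically. -/
theorem realWave_pos_of_nonneg (hq : Continuous q) {ω : ℝ} (h : ∀ ξ, 0 ≤ J.realWave ω ξ)
    (ξ : ℝ) : 0 < J.realWave ω ξ := by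
  refine (h ξ).lt_of_ne' fun h0 => ?_
  obtain ⟨R, -, hR⟩ := J.exists_realWave_pos
  have hmin : IsLocalMin (J.realWave ω) ξ := Eventually.of_forall fun x => by
    rw [h0]; exact h x
  have h1 : J.realWaveDeriv ω ξ = 0 := hmin.hasDerivAt_eq_zero (J.hasDerivAt_realWave ω ξ)
  refine (hR ω R le_rfl).ne' (eq_zero_of_cauchy_data (Q := fun ξ => q ξ + ω ^ 2)
    (by fun_prop) (J.hasDerivAt_realWave ω) (fun t => ?_) h0 h1 R)
  rw [smul_eq_mul]
  exact J.hasDerivAt_realWaveDeriv ω t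

theorem hasDerivAt_realWave_mul (ω ξ : ℝ) :
    HasDerivAt (fun ξ => J.realWave ω ξ * J.realWaveDeriv ω ξ)
      (J.realWaveDeriv ω ξ ^ 2 + (q ξ + ω ^ 2) * J.realWave ω ξ ^ 2) ξ :=
  ((J.hasDerivAt_realWave ω ξ).mul (J.hasDerivAt_realWaveDeriv ω ξ)).congr_deriv (by ring)

theorem tendsto_exp_neg_mul {ω : ℝ} (hω : 0 < ω) :
    Tendsto (fun ξ : ℝ => Real.exp (-(|ω| * ξ))) atTop (𝓝 0) := by
  refine Real.tendsto_exp_atBot.comp (tendsto_neg_atTop_atBot.comp ?_)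
  exact tendsto_id.const_mul_atTop (abs_pos.2 hω.ne')

theorem tendsto_realWave {ω : ℝ} (hω : 0 < ω) : Tendsto (J.realWave ω) atTop (𝓝 0) := by
  have h := (tendsto_exp_neg_mul hω).mul
    ((Complex.continuous_re.tendsto 1).comp (J.tendsto_m (imagPoint ω)))
  rwa [zero_mul] at h

theorem tendsto_realWaveDeriv {ω : ℝ} (hω : 0 < ω) :
    Tendsto (J.realWaveDeriv ω) atTop (𝓝 0) := by
  have h := (tendsto_exp_neg_mul hω).mul
    (((Complex.continuous_re.tendsto 0).comp (J.tendsto_n (imagPoint ω))).sub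
      (((Complex.continuous_re.tendsto 1).comp (J.tendsto_m (imagPoint ω))).const_mul |ω|))
  rwa [zero_mul] at h

/-- For large energies the decaying solution has no zeros. -/
theorem realWave_pos_of_potential_nonneg {ω : ℝ} (hω : 0 < ω) (hV : ∀ ξ, 0 ≤ q ξ + ω ^ 2)
    (ξ : ℝ) : 0 < J.realWave ω ξ := by
  obtain ⟨R, -, hR⟩ := J.exists_realWave_pos
  set B : ℝ → ℝ := fun ξ => J.realWave ω ξ * J.realWaveDeriv ω ξ with hB
  have hmono : Monotone B :=
    monotone_of_deriv_nonneg (fun x => (J.hasDerivAt_realWave_mul ω x).differentiableAt)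
      fun x => by
        rw [(J.hasDerivAt_realWave_mul ω x).deriv]
        have := hV x
        positivity
  have hlim : Tendsto B atTop (𝓝 0) := by
    have h := (J.tendsto_realWave hω).mul (J.tendsto_realWaveDeriv hω)
    rwa [zero_mul] at h
  -- `u u'` increases to `0`. At a zero of `u` it is already `0`, so it stays `0` to the right and
  -- `u²` is constant there, against positivity near `+∞`.
  have hle : ∀ x, B x ≤ 0 := fun x => hmono.ge_of_tendsto hlim x
  refine pos_on_Icc_of_ne_zero (J.continuous_realWave_right ω) (le_max_left ξ R)
    (hR ω _ (le_max_right ξ R)) fun z _ hz => ?_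
  have hBz : ∀ x, z ≤ x → B x = 0 := fun x hx =>
    le_antisymm (hle x) (by rw [← show B z = 0 by simp [hB, hz]]; exact hmono hx)
  have hsq : J.realWave ω (max z R) ^ 2 = J.realWave ω z ^ 2 := by
    refine constant_of_derivWithin_zero (a := z) (b := max z R)
      (f := fun x => J.realWave ω x ^ 2) (fun x _ => ?_) (fun x hx => ?_) _
      (Set.right_mem_Icc.2 (le_max_left _ _))
    · exact ((J.hasDerivAt_realWave ω x).pow 2).differentiableAt.differentiableWithinAt
    · have h1 : HasDerivAt (fun x => J.realWave ω x ^ 2) 0 x := by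
        refine ((J.hasDerivAt_realWave ω x).pow 2).congr_deriv ?_
        have := hBz x hx.1
        simp only [hB] at this
        push_cast
        linear_combination 2 * this
      exact h1.hasDerivWithinAt.derivWithin
        (uniqueDiffOn_Icc (lt_of_le_of_lt hx.1 hx.2) x (Set.Ico_subset_Icc_self hx))
  rw [hz] at hsq
  have := hR ω _ (le_max_right z R)
  simp at hsq
  exact this.ne' hsq

/-- The decaying solution grows towards `-∞` unless it is a bound state. -/
theorem exists_realWave_mul_neg (hq : Continuous q) (hb : ¬ HasBoundState q) {ω : ℝ} (hω : 0 < ω)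
    {ε c : ℝ} (hε : 0 < ε) (hV : ∀ ξ, ξ ≤ c → ε ≤ q ξ + ω ^ 2) :
    ∃ ξ, ξ ≤ c ∧ J.realWave ω ξ * J.realWaveDeriv ω ξ < 0 := by
  by_contra! hcon
  obtain ⟨R, hR0, hR⟩ := J.exists_realWave_pos
  have hcont := J.continuous_realWave_right ω
  -- If `u u' ≥ 0` to the left of `c`, integrating `(u u')' ≥ ε u²` bounds `ε ∫ u²` by `u u'` at
  -- `c`. With exponential decay at `+∞`, `u` would then be a bound state.
  have hleft : IntegrableOn (fun ξ => J.realWave ω ξ ^ 2) (Set.Iic c) := by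
    refine integrableOn_Iic_of_intervalIntegral_norm_bounded (l := atBot) (a := id)
      (ε⁻¹ * (J.realWave ω c * J.realWaveDeriv ω c)) c
      (fun i => (hcont.pow 2).integrableOn_Ioc) tendsto_id ?_
    filter_upwards [eventually_le_atBot c] with x hx
    have hcV : Continuous fun ξ =>
        J.realWaveDeriv ω ξ ^ 2 + (q ξ + ω ^ 2) * J.realWave ω ξ ^ 2 := by
      have : Continuous (J.realWaveDeriv ω) :=
        continuous_iff_continuousAt.2 fun ξ => (J.hasDerivAt_realWaveDeriv ω ξ).continuousAt
      fun_prop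
    have h1 := intervalIntegral.integral_eq_sub_of_hasDerivAt (a := x) (b := c)
      (fun y _ => J.hasDerivAt_realWave_mul ω y) (hcV.intervalIntegrable _ _)
    have h2 : ∫ y in x..c, ‖J.realWave ω y ^ 2‖ ≤
        ∫ y in x..c, ε⁻¹ *
          (J.realWaveDeriv ω y ^ 2 + (q y + ω ^ 2) * J.realWave ω y ^ 2) := by
      refine intervalIntegral.integral_mono_on hx ((by fun_prop : Continuous _).intervalIntegrable _ _)
        ((by fun_prop : Continuous _).intervalIntegrable _ _) fun y hy => ?_
      rw [Real.norm_of_nonneg (sq_nonneg _), ← div_eq_inv_mul, le_div_iff₀ hε]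
      have := mul_le_mul_of_nonneg_right (hV y hy.2) (sq_nonneg (J.realWave ω y))
      nlinarith [sq_nonneg (J.realWaveDeriv ω y)]
    refine h2.trans ?_
    rw [intervalIntegral.integral_const_mul, h1]
    gcongr
    have := hcon x hx
    linarith
  have hright : IntegrableOn (fun ξ => J.realWave ω ξ ^ 2) (Set.Ioi c) := by
    refine integrable_of_isBigO_exp_neg (b := 2 * |ω|) (by have := abs_pos.2 hω.ne'; positivity)
      (hcont.pow 2).continuousOn ?_
    have hlim := ((Complex.continuous_re.tendsto 1).comp (J.tendsto_m (imagPoint ω))).pow 2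
    have hO := (Asymptotics.isBigO_refl (fun ξ : ℝ => Real.exp (-(2 * |ω|) * ξ)) atTop).mul
      (hlim.isBigO_one ℝ)
    simp only [mul_one] at hO
    refine hO.congr_left fun ξ => ?_
    simp only [Function.comp, realWave, mul_pow, ← Real.exp_nat_mul]
    congr 2
    push_cast; ring
  have hint : Integrable fun ξ => J.realWave ω ξ ^ 2 := by
    rw [← integrableOn_univ, ← Set.Iic_union_Ioi (a := c)]
    exact hleft.union hright
  refine hb ⟨ω, hω, fun ξ => (J.realWave ω ξ : ℂ), fun h0 => ?_, ?_, ?_⟩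
  · have := congrFun h0 R
    simp only [Pi.zero_apply, Complex.ofReal_eq_zero] at this
    exact (hR ω R le_rfl).ne' this
  · refine IsWave.of_hasDerivAt hq (fun ξ => (J.hasDerivAt_realWave ω ξ).ofReal_comp)
      (fun ξ => (J.hasDerivAt_realWaveDeriv ω ξ).ofReal_comp.congr_deriv ?_)
    rw [mul_pow, Complex.I_sq]; push_cast; ring
  · refine (memLp_two_iff_integrable_sq_norm
      (Complex.continuous_ofReal.comp hcont).aestronglyMeasurable).2 ?_
    simpa using hint

/-- Continuity in `ω`: the good set `U` contains a large `ω`, is closed in `(0, ∞)` because a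
nonnegative limit is positive, and is open. For openness, compactness handles a bounded interval and
`R` its right side. On the left, `u u' < 0` at one point persists under small changes of `ω` and, by
monotonicity of `u u'`, prevents zeros further left. -/
theorem realWave_pos_of_not_hasBoundState (hq : Continuous q) {B : ℝ} (hB : ∀ ξ, |q ξ| ≤ B)
    (hq0 : Tendsto q atBot (𝓝 0)) (hb : ¬ HasBoundState q) {ω : ℝ} (hω : 0 < ω) (ξ : ℝ) :
    0 < J.realWave ω ξ := by
  obtain ⟨R, hR0, hR⟩ := J.exists_realWave_pos
  set U : Set ℝ := {ω | 0 < ω ∧ ∀ ξ, 0 < J.realWave ω ξ} with hU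
  have hopen : IsOpen U := by
    rw [isOpen_iff_mem_nhds]
    rintro ω₀ ⟨hω₀, hpos⟩
    -- With `q > -ω₀²/4` near `-∞`, the potential `q + ω²` stays nonnegative there for all `ω >
    -- ω₀/2`.
    have hε : 0 < ω₀ ^ 2 / 4 := by positivity
    obtain ⟨c, hc⟩ := eventually_atBot.1
      (hq0 (Metric.ball_mem_nhds 0 hε))
    have hqc : ∀ ξ, ξ ≤ min c 0 → -(ω₀ ^ 2 / 4) < q ξ := fun ξ hξ => by
      have h := hc ξ (hξ.trans (min_le_left _ _))
      rw [mem_ball_zero_iff, Real.norm_eq_abs] at h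
      exact (abs_lt.1 h).1
    obtain ⟨ξ₁, hξ₁, hneg⟩ := J.exists_realWave_mul_neg hq hb hω₀ hε (c := min c 0)
      (fun ξ hξ => by linarith [hqc ξ hξ])
    have hξ₁R : ξ₁ ≤ R := (hξ₁.trans (min_le_right _ _)).trans hR0
    have htube : ∀ᶠ ω in 𝓝 ω₀, ∀ ξ ∈ Set.Icc ξ₁ R, 0 < J.realWave ω ξ :=
      isCompact_Icc.eventually_forall_of_forall_eventually fun ξ _ =>
        J.continuous_realWave.continuousAt.eventually_const_lt (hpos ξ)
    have hdec : ∀ᶠ ω in 𝓝 ω₀, J.realWave ω ξ₁ * J.realWaveDeriv ω ξ₁ < 0 := by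
      have hc : Continuous fun ω => J.realWave ω ξ₁ * J.realWaveDeriv ω ξ₁ :=
        (J.continuous_realWave.comp (continuous_id.prodMk continuous_const)).mul
          (J.continuous_realWaveDeriv ξ₁)
      exact hc.continuousAt.eventually_lt_const hneg
    filter_upwards [htube, hdec, lt_mem_nhds (half_lt_self hω₀)] with ω h1 h2 h3
    refine ⟨by linarith, fun ξ => ?_⟩
    rcases le_total R ξ with h | h
    · exact hR ω ξ h
    rcases le_total ξ₁ ξ with h' | h'
    · exact h1 ξ ⟨h', h⟩
    · refine pos_on_Icc_of_ne_zero (J.continuous_realWave_right ω) h'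
        (h1 ξ₁ ⟨le_rfl, hξ₁R⟩) fun x hx hx0 => ?_
      have hmono : MonotoneOn (fun ξ => J.realWave ω ξ * J.realWaveDeriv ω ξ) (Set.Iic ξ₁) := by
        refine monotoneOn_of_deriv_nonneg (convex_Iic ξ₁)
          (fun y _ => (J.hasDerivAt_realWave_mul ω y).continuousAt.continuousWithinAt)
          (fun y _ => (J.hasDerivAt_realWave_mul ω y).differentiableAt.differentiableWithinAt)
          fun y hy => ?_
        rw [(J.hasDerivAt_realWave_mul ω y).deriv]
        rw [interior_Iic] at hy
        have h5 := hqc y ((le_of_lt hy).trans hξ₁)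
        have h6 : 0 ≤ q y + ω ^ 2 := by nlinarith
        positivity
      have h7 := hmono (Set.mem_Iic.2 hx.2) (Set.self_mem_Iic) hx.2
      simp only [hx0, zero_mul] at h7
      linarith
  have hne : (Set.Ioi 0 ∩ U).Nonempty := by
    have hB0 : 0 ≤ B := (abs_nonneg _).trans (hB 0)
    have h1 : 0 < B + 1 := by linarith
    refine ⟨B + 1, h1, h1, J.realWave_pos_of_potential_nonneg h1 fun ξ => ?_⟩
    nlinarith [(abs_le.1 (hB ξ)).1]
  have hcl : closure U ∩ Set.Ioi 0 ⊆ U := by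
    rintro ω₀ ⟨hcl, hω₀⟩
    refine ⟨hω₀, J.realWave_pos_of_nonneg hq fun ξ => ?_⟩
    have hc : Continuous fun ω => J.realWave ω ξ :=
      J.continuous_realWave.comp (continuous_id.prodMk continuous_const)
    exact closure_minimal (fun ω (hω : ω ∈ U) => (hω.2 ξ).le)
      (isClosed_le continuous_const hc) hcl
  exact (isPreconnected_Ioi.subset_of_closure_inter_subset hopen hne hcl hω).2 ξ

theorem realWave_zero_pos (hq : Continuous q) {B : ℝ} (hB : ∀ ξ, |q ξ| ≤ B)
    (hq0 : Tendsto q atBot (𝓝 0)) (hb : ¬ HasBoundState q) (ξ : ℝ) : 0 < J.realWave 0 ξ := by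
  refine J.realWave_pos_of_nonneg hq (fun ξ => ?_) ξ
  have hc : Continuous fun ω => J.realWave ω ξ :=
    J.continuous_realWave.comp (continuous_id.prodMk continuous_const)
  refine ge_of_tendsto ((hc.tendsto 0).mono_left (nhdsWithin_le_nhds (s := Set.Ioi 0))) ?_
  filter_upwards [self_mem_nhdsWithin] with ω hω
  exact (J.realWave_pos_of_not_hasBoundState hq hB hq0 hb hω ξ).le

end JostSolution

/-! ### Decay of the wave function at zero energy -/

theorem exists_abs_le_of_tendsto_cocompact {f : ℝ → ℝ} (hf : Continuous f) {l : ℝ}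
    (h : Tendsto f (cocompact ℝ) (𝓝 l)) : ∃ K, ∀ x, |f x| ≤ K := by
  have h1 : ∀ᶠ x in cocompact ℝ, |f x| < |l| + 1 := h.abs.eventually_lt_const (by linarith)
  obtain ⟨s, hs, hsub⟩ := mem_cocompact.1 h1
  obtain ⟨K, hK⟩ := hs.exists_bound_of_continuousOn hf.continuousOn
  refine ⟨max K (|l| + 1), fun x => ?_⟩
  by_cases hx : x ∈ s
  · exact (hK x hx).trans (le_max_left _ _)
  · exact (le_of_lt (hsub hx)).trans (le_max_right _ _)

/-- Integration from infinity costs one power of `1 + x²`; the negative half-line follows by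
reflection. -/
theorem RapidDecay.of_hasDerivAt {f f' : ℝ → ℝ} (hf : ∀ x, HasDerivAt f (f' x) x)
    (hf' : RapidDecay f') (h0 : Tendsto f (cocompact ℝ) (𝓝 0)) : RapidDecay f := by
  intro N
  obtain ⟨C, hC⟩ := hf' (N + 1)
  have hC0 : 0 ≤ C := le_trans (by positivity) (hC 0)
  have key : ∀ (g g' : ℝ → ℝ), (∀ x, HasDerivAt g (g' x) x) →
      (∀ x, |g' x| * (1 + x ^ 2) ^ (N + 1) ≤ C) → Tendsto g atTop (𝓝 0) →
      ∀ a, 0 ≤ a → |g a| * (1 + a ^ 2) ^ N ≤ C * Real.pi := by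
    intro g g' hg hg' hg0 a ha
    have h := norm_le_of_tendsto_zero (a := a) (c := C * ((1 + a ^ 2) ^ N)⁻¹) hg hg0
      fun x hx => by
        have h1 : |g' x| ≤ C * ((1 + x ^ 2) ^ (N + 1))⁻¹ := by
          rw [← div_eq_mul_inv, le_div_iff₀ (by positivity)]; exact hg' x
        refine h1.trans ?_
        rw [pow_succ, mul_inv, ← mul_assoc]
        gcongr
    rw [Real.norm_eq_abs] at h
    calc |g a| * (1 + a ^ 2) ^ N ≤ C * ((1 + a ^ 2) ^ N)⁻¹ * Real.pi * (1 + a ^ 2) ^ N := by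
          gcongr
      _ = C * Real.pi := by
        have : (1 + a ^ 2) ^ N ≠ 0 := by positivity
        field_simp
  rw [cocompact_eq_atBot_atTop, tendsto_sup] at h0
  refine ⟨C * Real.pi, fun x => ?_⟩
  rcases le_total 0 x with hx | hx
  · exact key f f' hf hC h0.2 x hx
  · have h := key (fun x => f (-x)) (fun x => -f' (-x))
      (fun x => ((hf (-x)).scomp x (hasDerivAt_neg x)).congr_deriv (by simp))
      (fun x => by simpa using hC (-x)) (h0.1.comp tendsto_neg_atTop_atBot) (-x) (by linarith)
    simpa using h

theorem isSchwartz_sub_one_of_hasDerivAt {q σ σ₁ : ℝ → ℝ} (hq : IsSchwartz q)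
    (h1 : ∀ ξ, HasDerivAt σ (σ₁ ξ) ξ) (h2 : ∀ ξ, HasDerivAt σ₁ (q ξ * σ ξ) ξ)
    (hσ : Tendsto σ (cocompact ℝ) (𝓝 1)) (hσ₁ : Tendsto σ₁ (cocompact ℝ) (𝓝 0)) :
    IsSchwartz fun ξ => σ ξ - 1 := by
  obtain ⟨K, hK⟩ := exists_abs_le_of_tendsto_cocompact
    (continuous_iff_continuousAt.2 fun ξ => (h1 ξ).continuousAt) hσ
  obtain ⟨K₁, hK₁⟩ := exists_abs_le_of_tendsto_cocompact
    (continuous_iff_continuousAt.2 fun ξ => (h2 ξ).continuousAt) hσ₁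
  have hqσ : IsSchwartz fun ξ => q ξ * σ ξ := by
    -- The equation closes this family: `(gσ + hσ₁)' = (g' + hq)σ + (g + h')σ₁`. Thus `σ'' = qσ` is
    -- Schwartz, and integrating twice from infinity gives `σ₁` and `σ - 1`.
    refine IsSchwartz.of_family {f | ∃ g h, IsSchwartz g ∧ IsSchwartz h ∧
      f = fun ξ => g ξ * σ ξ + h ξ * σ₁ ξ} ?_ ?_ ⟨q, fun ξ => 0 * q ξ, hq, hq.const_mul 0, ?_⟩
    · rintro _ ⟨g, h, hg, hh, rfl⟩ N
      obtain ⟨A, hA⟩ := hg.rapidDecay N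
      obtain ⟨B, hB⟩ := hh.rapidDecay N
      refine ⟨A * K + B * K₁, fun x => ?_⟩
      have hA0 : 0 ≤ A := le_trans (by positivity) (hA x)
      have hB0 : 0 ≤ B := le_trans (by positivity) (hB x)
      calc |g x * σ x + h x * σ₁ x| * (1 + x ^ 2) ^ N
          ≤ (|g x| * |σ x| + |h x| * |σ₁ x|) * (1 + x ^ 2) ^ N := by
            gcongr
            rw [← abs_mul, ← abs_mul]
            exact abs_add_le _ _
        _ = |g x| * (1 + x ^ 2) ^ N * |σ x| + |h x| * (1 + x ^ 2) ^ N * |σ₁ x| := by ring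
        _ ≤ A * K + B * K₁ := by
          gcongr
          exacts [hA x, hK x, hB x, hK₁ x]
    · rintro _ ⟨g, h, hg, hh, rfl⟩
      obtain ⟨g', hg', hdg⟩ := hg.exists_hasDerivAt
      obtain ⟨h', hh', hdh⟩ := hh.exists_hasDerivAt
      refine ⟨_, ⟨_, _, hg'.add (hh.mul hq), hg.add hh', rfl⟩, fun ξ => ?_⟩
      exact (((hdg ξ).mul (h1 ξ)).add ((hdh ξ).mul (h2 ξ))).congr_deriv (by ring)
    · funext ξ; ring
  have hs1 : IsSchwartz σ₁ :=
    IsSchwartz.of_hasDerivAt (RapidDecay.of_hasDerivAt h2 hqσ.rapidDecay hσ₁) h2 hqσ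
  refine IsSchwartz.of_hasDerivAt (RapidDecay.of_hasDerivAt (fun ξ => (h1 ξ).sub_const 1)
    hs1.rapidDecay ?_) (fun ξ => (h1 ξ).sub_const 1) hs1
  simpa using hσ.sub_const 1

theorem exists_isLiouvilleTransform_of_wave {q σ σ₁ : ℝ → ℝ} (hq : IsSchwartz q)
    (h1 : ∀ ξ, HasDerivAt σ (σ₁ ξ) ξ) (h2 : ∀ ξ, HasDerivAt σ₁ (q ξ * σ ξ) ξ)
    (hpos : ∀ ξ, 0 < σ ξ)
    (hσ : Tendsto σ (cocompact ℝ) (𝓝 1)) (hσ₁ : Tendsto σ₁ (cocompact ℝ) (𝓝 0)) :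
    ∃ ρ : ℝ → ℝ, IsAcoustic ρ ∧ IsLiouvilleTransform ρ q := by
  have hσa : IsAcoustic σ := ⟨hpos, isSchwartz_sub_one_of_hasDerivAt hq h1 h2 hσ hσ₁⟩
  have hr := hσa.sq.inv
  -- The coefficient with `ρ_s = σ²` is the image of the slowness `1/σ²` under the involution.
  have hs : (fun ξ => √(rhoS (fun ξ => 1 / rhoS (fun ξ => 1 / σ ξ ^ 2) ξ) ξ)) = σ := by
    funext ξ
    rw [hr.rhoS_inv_rhoS, one_div_one_div, Real.sqrt_sq (hpos ξ).le]
  refine ⟨_, hr.rhoS.inv, (hr.rhoS.inv.isLiouvilleTransform_iff (σ₁ := σ₁) (by rwa [hs]) h2 q).2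
    fun ξ => ?_⟩
  rw [congrFun hs ξ]

/-! ### The image of the Liouville transform -/

theorem IsSchwartz.nonempty_jostSolution {q : ℝ → ℝ} (hq : IsSchwartz q) :
    Nonempty (JostSolution q) ∧ Nonempty (JostSolution fun ξ => q (-ξ)) := by
  obtain ⟨C, hC⟩ := hq.rapidDecay 4
  have hc := hq.continuous
  exact ⟨JostSolution.exists hc hC,
    JostSolution.exists (by fun_prop) fun y => by simpa using hC (-y)⟩

theorem imagPoint_zero : imagPoint 0 = realPoint 0 := Subtype.ext (by simp)

namespace JostSolution

variable {q : ℝ → ℝ} (J : JostSolution q)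

theorem wave_zero : J.wave (realPoint 0) = J.m (realPoint 0) := by
  funext ξ; simp [wave]

theorem waveDeriv_zero : J.waveDeriv (realPoint 0) = J.n (realPoint 0) := by
  funext ξ; simp [waveDeriv]

theorem hasDerivAt_waveDeriv_zero (ξ : ℝ) :
    HasDerivAt (J.waveDeriv (realPoint 0)) (q ξ * J.wave (realPoint 0) ξ) ξ :=
  (J.hasDerivAt_waveDeriv (realPoint 0) ξ).congr_deriv (by simp)

end JostSolution

theorem hasDerivAt_waveDeriv_neg_zero {q : ℝ → ℝ} (L : JostSolution fun ξ => q (-ξ)) (ξ : ℝ) :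
    HasDerivAt (fun ξ => -L.waveDeriv (realPoint 0) (-ξ))
      (q ξ * L.wave (realPoint 0) (-ξ)) ξ :=
  (hasDerivAt_waveDeriv_neg L (realPoint 0) ξ).congr_deriv (by simp)

/-- The left and right wave functions at zero energy of a Liouville transform coincide. -/
theorem IsLiouvilleTransform.wave_neg_eq {ρ q : ℝ → ℝ} (hρ : IsAcoustic ρ)
    (hq : IsLiouvilleTransform ρ q) (L : JostSolution fun ξ => q (-ξ)) (ξ : ℝ) :
    L.wave (realPoint 0) (-ξ) = (√(rhoS ρ ξ) : ℂ) := by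
  obtain ⟨σ₁, hs1, h1, h2⟩ := hq.exists_hasDerivAt hρ
  have hqc := (hq.isSchwartz hρ).continuous
  have d1 := fun ξ => (h1 ξ).ofReal_comp
  have d2 : ∀ ξ, HasDerivAt (fun ξ => (σ₁ ξ : ℂ)) ((q ξ : ℂ) * (√(rhoS ρ ξ) : ℂ)) ξ := fun ξ =>
    (h2 ξ).ofReal_comp.congr_deriv (by push_cast; rfl)
  have lσ : Tendsto (fun ξ => (√(rhoS ρ ξ) : ℂ)) atBot (𝓝 1) :=
    (Complex.continuous_ofReal.tendsto 1).comp
      (hρ.tendsto_sqrt_rhoS.mono_left atBot_le_cocompact)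
  have lσ₁ : Tendsto (fun ξ => (σ₁ ξ : ℂ)) atBot (𝓝 0) :=
    (Complex.continuous_ofReal.tendsto 0).comp
      (hs1.rapidDecay.tendsto_cocompact.mono_left atBot_le_cocompact)
  have lL : Tendsto (fun ξ => L.wave (realPoint 0) (-ξ)) atBot (𝓝 1) := by
    rw [L.wave_zero]
    exact (L.tendsto_m _).comp tendsto_neg_atBot_atTop
  have lL₁ : Tendsto (fun ξ => -L.waveDeriv (realPoint 0) (-ξ)) atBot (𝓝 0) := by
    rw [L.waveDeriv_zero]
    simpa using ((L.tendsto_n _).comp tendsto_neg_atBot_atTop).neg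
  -- Both solutions tend to 1 with vanishing derivative at `-∞`, so their Wronskian is zero.
  have hW : L.wave (realPoint 0) (-0) * (σ₁ 0 : ℂ) -
      -L.waveDeriv (realPoint 0) (-0) * (√(rhoS ρ 0) : ℂ) = 0 := by
    have h := (lL.mul lσ₁).sub (lL₁.mul lσ)
    rw [mul_zero, zero_mul, sub_zero] at h
    refine tendsto_nhds_unique (tendsto_const_nhds (f := atBot (α := ℝ))) (h.congr fun ξ => ?_)
    exact wronskian_eq (Q := fun t => (q t : ℂ)) (hasDerivAt_wave_neg L (realPoint 0))
      (hasDerivAt_waveDeriv_neg_zero L) d1 d2 ξ 0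
  obtain ⟨c, hc⟩ := exists_eq_const_mul hqc (hasDerivAt_wave_neg L (realPoint 0))
    (hasDerivAt_waveDeriv_neg_zero L) d1 d2 hW (b := 0)
    (Complex.ofReal_ne_zero.2 (hρ.rhoS.sqrt.1 0).ne')
  have hc1 : c = 1 := by
    have h := lσ.const_mul c
    rw [mul_one] at h
    exact tendsto_nhds_unique h (lL.congr hc)
  rw [hc, hc1, one_mul]

theorem IsLiouvilleTransform.aZeroEqOne {ρ q : ℝ → ℝ} (hρ : IsAcoustic ρ)
    (hq : IsLiouvilleTransform ρ q) : AZeroEqOne q := by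
  have hqs := hq.isSchwartz hρ
  obtain ⟨⟨J⟩, ⟨L⟩⟩ := hqs.nonempty_jostSolution
  have hJ := (hq.isRightWave_zero_iff hρ _).1 (J.isRightWave hqs.continuous 0)
  refine ⟨_, _, isScatteringData_jost J L hqs.continuous, ?_⟩
  have h := tendsto_jostWronskian_div J L one_ne_zero (fun ξ => by
    rw [one_mul, hq.wave_neg_eq hρ L, hJ]) (by
    rw [hJ]; exact Complex.ofReal_ne_zero.2 (hρ.rhoS.sqrt.1 0).ne')
  simpa using h

theorem exists_isLiouvilleTransform {q : ℝ → ℝ} (hq : IsSchwartz q) (hb : ¬ HasBoundState q)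
    (ha : AZeroEqOne q) : ∃ ρ : ℝ → ℝ, IsAcoustic ρ ∧ IsLiouvilleTransform ρ q := by
  obtain ⟨⟨J⟩, ⟨L⟩⟩ := hq.nonempty_jostSolution
  have hqc := hq.continuous
  obtain ⟨a, b, hab, hlim⟩ := ha
  have hq0 := hq.rapidDecay.tendsto_cocompact
  obtain ⟨B, hB⟩ := exists_abs_le_of_tendsto_cocompact hqc hq0
  have hpos := J.realWave_zero_pos hqc hB (hq0.mono_left atBot_le_cocompact) hb
  have hre : ∀ ξ, J.realWave 0 ξ = (J.wave (realPoint 0) ξ).re := fun ξ => by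
    rw [J.realWave_eq, imagPoint_zero]
  have hre₁ : ∀ ξ, J.realWaveDeriv 0 ξ = (J.waveDeriv (realPoint 0) ξ).re := fun ξ => by
    rw [J.realWaveDeriv_eq, imagPoint_zero]
  have hJ0 : J.wave (realPoint 0) 0 ≠ 0 := fun h => by
    have := hpos 0
    rw [hre, h] at this
    simp at this
  have hWa : ∀ k : ℝ, k ≠ 0 → a k * (2 * Complex.I * k) = jostWronskian J L k :=
    fun k hk => hab.mul_eq_jostWronskian J L hqc hk
  -- The Wronskian is continuous at `k = 0` and equals `2ik a(k)` with `a` convergent.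
  have hW0 : jostWronskian J L 0 = 0 := by
    have h1 : Tendsto (jostWronskian J L) (𝓝[≠] 0) (𝓝 (jostWronskian J L 0)) :=
      ((L.tendsto_wave 0).mul (J.tendsto_waveDeriv 0)).add
        ((L.tendsto_waveDeriv 0).mul (J.tendsto_wave 0))
    have h2 : Tendsto (fun k : ℝ => 2 * Complex.I * (k : ℂ)) (𝓝[≠] 0) (𝓝 0) := by
      have h : Tendsto (fun k : ℝ => 2 * Complex.I * (k : ℂ)) (𝓝 0)
          (𝓝 (2 * Complex.I * ((0 : ℝ) : ℂ))) :=
        (by fun_prop : Continuous fun k : ℝ => 2 * Complex.I * (k : ℂ)).tendsto 0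
      rw [Complex.ofReal_zero, mul_zero] at h
      exact h.mono_left nhdsWithin_le_nhds
    have h3 := hlim.mul h2
    rw [mul_zero] at h3
    refine tendsto_nhds_unique h1 (h3.congr' ?_)
    filter_upwards [self_mem_nhdsWithin] with k hk using hWa k hk
  obtain ⟨c, hc⟩ := exists_eq_const_mul hqc (hasDerivAt_wave_neg L (realPoint 0))
    (hasDerivAt_waveDeriv_neg_zero L) (J.hasDerivAt_wave (realPoint 0))
    J.hasDerivAt_waveDeriv_zero (a := 0) (b := 0)
    (by rw [jostWronskian] at hW0; rw [neg_zero]; linear_combination hW0) hJ0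
  have lL : Tendsto (fun ξ => L.wave (realPoint 0) (-ξ)) atBot (𝓝 1) := by
    rw [L.wave_zero]
    exact (L.tendsto_m _).comp tendsto_neg_atBot_atTop
  have hc0 : c ≠ 0 := by
    rintro rfl
    refine zero_ne_one (tendsto_nhds_unique (tendsto_const_nhds (x := (0 : ℂ))) (lL.congr fun ξ => ?_))
    rw [hc, zero_mul]
  have hc1 : c = 1 := by
    have h := tendsto_nhds_unique hlim ((tendsto_jostWronskian_div J L hc0 hc hJ0).congr' (by
      filter_upwards [self_mem_nhdsWithin] with k hk
      rw [← hWa k hk, mul_div_assoc, div_self (by simpa using hk), mul_one]))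
    field_simp at h
    -- `(c + c⁻¹)/2 = 1` has the double root `c = 1`; here the value of `a(0)`, and not only its
    -- finiteness, is used.
    have h' : (c - 1) ^ 2 = 0 := by linear_combination -h
    exact sub_eq_zero.1 (pow_eq_zero_iff two_ne_zero |>.1 h')
  subst hc1
  simp only [one_mul] at hc
  have hc' : ∀ ξ, -L.waveDeriv (realPoint 0) (-ξ) = J.waveDeriv (realPoint 0) ξ := fun ξ => by
    have h := hasDerivAt_wave_neg L (realPoint 0) ξ
    rw [funext hc] at h
    exact h.unique (J.hasDerivAt_wave (realPoint 0) ξ)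
  have lσ : Tendsto (J.wave (realPoint 0)) (cocompact ℝ) (𝓝 1) := by
    rw [cocompact_eq_atBot_atTop, tendsto_sup]
    refine ⟨lL.congr hc, ?_⟩
    rw [J.wave_zero]
    exact J.tendsto_m _
  have lσ₁ : Tendsto (J.waveDeriv (realPoint 0)) (cocompact ℝ) (𝓝 0) := by
    rw [cocompact_eq_atBot_atTop, tendsto_sup]
    constructor
    · have h := ((L.tendsto_n (realPoint 0)).comp tendsto_neg_atBot_atTop).neg
      rw [neg_zero, ← L.waveDeriv_zero] at h
      exact h.congr hc'
    · rw [J.waveDeriv_zero]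
      exact J.tendsto_n _
  refine exists_isLiouvilleTransform_of_wave hq (J.hasDerivAt_realWave 0)
    (fun ξ => (J.hasDerivAt_realWaveDeriv 0 ξ).congr_deriv (by ring)) hpos ?_ ?_
  · rw [funext hre]
    exact (Complex.continuous_re.tendsto 1).comp lσ
  · rw [funext hre₁]
    exact (Complex.continuous_re.tendsto 0).comp lσ₁

theorem theorem3p2 :
    -- the Liouville transform of every acoustic operator is a well-defined Schrödinger operator
    (∀ ρ : ℝ → ℝ, IsAcoustic ρ →
      Function.Bijective (travelTime ρ) ∧ ∃! q : ℝ → ℝ, IsLiouvilleTransform ρ q) ∧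
    -- the image
    (∀ q : ℝ → ℝ,
      (∃ ρ : ℝ → ℝ, IsAcoustic ρ ∧ IsLiouvilleTransform ρ q) ↔
        (IsSchwartz q ∧ ¬ HasBoundState q ∧ AZeroEqOne q)) ∧
    -- the inversion; `ψ` is the wave function `ψ_s(·, 0)`
    (∀ ρ q : ℝ → ℝ, IsAcoustic ρ → IsLiouvilleTransform ρ q →
      ∃ ψ : ℝ → ℂ,
        (∀ χ : ℝ → ℂ, IsRightWave q 0 χ ↔ χ = ψ) ∧
        (∀ ξ : ℝ, (rhoS ρ ξ : ℂ) = ψ ξ ^ 2) ∧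
        Integrable (fun ξ : ℝ => 1 / rhoS ρ ξ - 1) (volume : Measure ℝ) ∧
        (∀ x ξ : ℝ, travelTime ρ x = ξ ↔
          x = ξ + ∫ η in Set.Iic ξ, (1 / rhoS ρ η - 1))) := by
  refine ⟨fun ρ hρ => ⟨hρ.bijective_travelTime, hρ.existsUnique_isLiouvilleTransform⟩,
    fun q => ⟨?_, fun ⟨hq, hb, ha⟩ => exists_isLiouvilleTransform hq hb ha⟩,
    fun ρ q hρ hq => ⟨_, hq.isRightWave_zero_iff hρ, fun ξ => ?_, hρ.rhoS.inv.2.integrable,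
      fun x ξ => ?_⟩⟩
  · rintro ⟨ρ, hρ, hq⟩
    exact ⟨hq.isSchwartz hρ, hq.not_hasBoundState hρ, hq.aZeroEqOne hρ⟩
  · exact_mod_cast (Real.sq_sqrt (hρ.rhoS.1 ξ).le).symm
  · have h : ξ + ∫ η in Set.Iic ξ, (1 / rhoS ρ η - 1) = travelTimeInv ρ ξ :=
      congrFun hρ.travelTime_inv_rhoS ξ
    rw [h]
    constructor
    · rintro rfl
      exact (hρ.travelTimeInv_travelTime x).symm
    · rintro rfl
      exact hρ.travelTime_travelTimeInv ξ
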